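/- Let $d\in\{2,3\}$, let $\Omega\subset\mathbb{R}^d$ be a bounded open set (for instance a bounded Lipschitz polyhedral or polygonal domain, not necessarily convex or simply connected), and let $R_e,R_m,S_c>0$. Write $(\cdot,\cdot)$ and $\|\cdot\|_{L^2}$ for the inner product and norm of $L^2(\Omega)$ (scalar or vector valued), and $\|\nabla \mathbf u\|_{L^2}^2=\sum_{i}\|\partial_i\mathbf u\|_{L^2}^2$. For $d=3$, $\mathbf{curl}$ and $\times$ are the usual ones; for $d=2$, $\mathbf{curl}\,\mathbf B=\partial_1B_2-\partial_2B_1$ and $\mathbf u\times\mathbf B=u_1B_2-u_2B_1$ are scalars, and for a scalar $s$, $\mathbf{curl}\,s=(\partial_2 s,-\partial_1 s)$ and $s\times\mathbf B=(-sB_2,sB_1)$. Let $I\subseteq\mathbb{R}$ be a set of times (for instance $(0,T)$, or a subset of $(0,T)$ of full measure), let $\mathbf f:\mathbb{R}\to L^2(\Omega)^d$, and let $\mathbf u,\mathbf B:\mathbb{R}\to L^2(\Omega)^d$, $p:\mathbb{R}\to L^2(\Omega)$ be such that for every $t\in I$: * (regularity) $\mathbf u$ and $\mathbf B$ are differentiable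 at $t$ as maps into $L^2(\Omega)^d$; $\mathbf u(t)\in W^{1,3}(\Omega)^d\cap L^\infty(\Omega)^d$; $\mathbf B(t)\in L^3(\Omega)^d$; $\mathbf{curl}\,\mathbf B(t)\in L^2$ and $\mathbf{curl}\,\mathbf{curl}\,\mathbf B(t)\in L^2$; * (equations) in the sense of distributions on $\Omega$, at time $t$, $$\partial_t\mathbf u-\tfrac1{R_e}\Delta\mathbf u+\mathbf u\cdot\nabla\mathbf u+\nabla p-S_c\,\mathbf{curl}\,\mathbf B\times\mathbf B=\mathbf f,$$ $$\partial_t\mathbf B+\tfrac{S_c}{R_m}\mathbf{curl}\,(\mathbf{curl}\,\mathbf B)-S_c\,\mathbf{curl}\,(\mathbf u\times\mathbf B)=\mathbf 0,\qquad \nabla\cdot\mathbf u=0,\qquad \nabla\cdot\mathbf B=0;$$ * (boundary conditions) $\mathbf u=\mathbf 0$, $\mathbf B\cdot\mathbf n=0$ and $\mathbf{curl}\,\mathbf B\times\mathbf n=\mathbf 0$ on $\partial\Omega$, in the usual Sobolev sense: $\mathbf u(t)\in W^{1,3}_0(\Omega)^d$, $\mathbf B(t)\in H_0(\mathrm{div},\Omega)$,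 $\mathbf{curl}\,\mathbf B(t)\in H_0(\mathbf{curl},\Omega)$, where the subscript $0$ denotes the closure of $C_c^\infty(\Omega)$ in the respective norm (for $d=2$ the last condition says that the scalar $\mathbf{curl}\,\mathbf B(t)$ lies in $H^1_0(\Omega)$). Then for every $t\in I$ the functions $\|\mathbf u\|_{L^2}^2$ and $\|\mathbf B\|_{L^2}^2$ are differentiable at $t$, and $$\frac12\frac{d}{dt}\|\mathbf u\|_{L^2}^2+\frac12\frac{d}{dt}\|\mathbf B\|_{L^2}^2+\frac1{R_e}\|\nabla\mathbf u\|_{L^2}^2+\frac{S_c}{R_m}\|\mathbf{curl}\,\mathbf B\|_{L^2}^2=(\mathbf f,\mathbf u).$$ -/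

import Mathlib

open MeasureTheory Filter Topology TopologicalSpace
open scoped Distributions

namespace MHD

noncomputable section

/-- The Euclidean space `ℝ^d`. -/
abbrev Vec (d : ℕ) := EuclideanSpace ℝ (Fin d)

/-- Lebesgue measure on `Ω`. -/
abbrev vol {d : ℕ} (Ω : Opens (Vec d)) : Measure (Vec d) :=
  (volume : Measure (Vec d)).restrict (Ω : Set (Vec d))

/-- The Hilbert space `L²(Ω; F)`; its norm and its `inner ℝ` are the `L²` ones. -/
abbrev L2 {d : ℕ} (Ω : Opens (Vec d)) (F : Type) [NormedAddCommGroup F] :=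
  Lp F 2 (vol Ω)

/-! ### Classical differential operators and vector products -/

/-- The partial derivative `∂ᵢ φ`. -/
def pd {d : ℕ} {F : Type} [NormedAddCommGroup F] [NormedSpace ℝ F]
    (i : Fin d) (φ : Vec d → F) (x : Vec d) : F :=
  fderiv ℝ φ x (EuclideanSpace.single i 1)

/-- The gradient of a scalar function. -/
def grad {d : ℕ} (φ : Vec d → ℝ) (x : Vec d) : Vec d :=
  WithLp.toLp 2 fun i => pd i φ x

/-- The divergence of a vector field. -/
def divergence {d : ℕ} (φ : Vec d → Vec d) (x : Vec d) : ℝ :=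
  ∑ i, pd i φ x i

/-- The curl of a three-dimensional vector field. -/
def curl3 (φ : Vec 3 → Vec 3) (x : Vec 3) : Vec 3 :=
  !₂[pd 1 φ x 2 - pd 2 φ x 1, pd 2 φ x 0 - pd 0 φ x 2, pd 0 φ x 1 - pd 1 φ x 0]

/-- The scalar curl `∂₁φ₂ - ∂₂φ₁` of a planar vector field. -/
def curl2 (φ : Vec 2 → Vec 2) (x : Vec 2) : ℝ :=
  pd 0 φ x 1 - pd 1 φ x 0

/-- The vector curl `(∂₂w, -∂₁w)` of a scalar function in the plane. -/
def vcurl2 (w : Vec 2 → ℝ) (x : Vec 2) : Vec 2 :=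
  !₂[pd 1 w x, -pd 0 w x]

/-- The cross product in `ℝ³`. -/
def cross3 (a b : Vec 3) : Vec 3 :=
  WithLp.toLp 2 (crossProduct (WithLp.ofLp a) (WithLp.ofLp b))

/-- The planar cross product of two vectors: the third component of
`(a₁, a₂, 0) × (b₁, b₂, 0)`. -/
def cross2 (a b : Vec 2) : ℝ := a 0 * b 1 - a 1 * b 0

/-- The planar product of a scalar and a vector: `(0, 0, s) × (b₁, b₂, 0)`. -/
def scross2 (s : ℝ) (b : Vec 2) : Vec 2 := !₂[-(s * b 1), s * b 0]

/-- The transport term `(u · ∇) v = ∑ᵢ uᵢ ∂ᵢ v`, given the partial derivatives `Dv i = ∂ᵢ v`. -/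
def advect {d : ℕ} (u : Vec d) (Dv : Fin d → Vec d) : Vec d := ∑ i, u i • Dv i

/-! ### Weak derivatives of `L²` functions -/

/-- `g = ∂ᵢ w` on `Ω` in the sense of distributions. -/
def HasWeakPartial {d : ℕ} {Ω : Opens (Vec d)} (i : Fin d) (w g : L2 Ω (Vec d)) : Prop :=
  ∀ φ : 𝓓(Ω, Vec d),
    ∫ x, inner ℝ (g x) (φ x) ∂(vol Ω) = - ∫ x, inner ℝ (w x) (pd i φ x) ∂(vol Ω)

/-- `h = div w` on `Ω` in the sense of distributions. -/
def HasWeakDiv {d : ℕ} {Ω : Opens (Vec d)} (w : L2 Ω (Vec d)) (h : L2 Ω ℝ) : Prop :=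
  ∀ ψ : 𝓓(Ω, ℝ),
    ∫ x, h x * ψ x ∂(vol Ω) = - ∫ x, inner ℝ (w x) (grad ψ x) ∂(vol Ω)

/-- `J = curl w` on `Ω ⊆ ℝ³` in the sense of distributions. -/
def HasWeakCurl3 {Ω : Opens (Vec 3)} (w J : L2 Ω (Vec 3)) : Prop :=
  ∀ φ : 𝓓(Ω, Vec 3),
    ∫ x, inner ℝ (J x) (φ x) ∂(vol Ω) = ∫ x, inner ℝ (w x) (curl3 φ x) ∂(vol Ω)

/-- `J = curl w` (scalar curl) on `Ω ⊆ ℝ²` in the sense of distributions. -/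
def HasWeakCurl2 {Ω : Opens (Vec 2)} (w : L2 Ω (Vec 2)) (J : L2 Ω ℝ) : Prop :=
  ∀ ψ : 𝓓(Ω, ℝ),
    ∫ x, J x * ψ x ∂(vol Ω) = ∫ x, inner ℝ (w x) (vcurl2 ψ x) ∂(vol Ω)

/-! ### Homogeneous boundary conditions

As usual for Sobolev functions, a homogeneous boundary condition means membership in the closure of
the test functions for the relevant norm. On a bounded Lipschitz domain this is the vanishing of the
corresponding trace. -/

/-- The test functions `φ n` converge to `w` in `L^q(Ω)` . -/
def TestTendsto {d : ℕ} {Ω : Opens (Vec d)} {F : Type} [NormedAddCommGroup F]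
    (q : ENNReal) (φ : ℕ → Vec d → F) (w : Vec d → F) : Prop :=
  Tendsto (fun n => eLpNorm (fun x => φ n x - w x) q (vol Ω)) atTop (𝓝 0)

/-- `u ∈ W^{1,3}_0(Ω)^d`, with partial derivatives `Du i`: `u` has weak derivatives in `L³`
and `u = 0` on `∂Ω`. -/
def ZeroOnBoundary {d : ℕ} {Ω : Opens (Vec d)}
    (u : L2 Ω (Vec d)) (Du : Fin d → L2 Ω (Vec d)) : Prop :=
  MemLp u 3 (vol Ω) ∧ (∀ i, MemLp (Du i) 3 (vol Ω)) ∧ (∀ i, HasWeakPartial i u (Du i)) ∧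
  ∃ φ : ℕ → 𝓓(Ω, Vec d),
    TestTendsto (Ω := Ω) 3 (fun n => φ n) u ∧
    ∀ i, TestTendsto (Ω := Ω) 3 (fun n => pd i (φ n)) (Du i)

/-- `w ∈ H₀(div, Ω)`: `div w ∈ L²` and `w · n = 0` on `∂Ω`. -/
def NormalTraceZero {d : ℕ} {Ω : Opens (Vec d)} (w : L2 Ω (Vec d)) : Prop :=
  ∃ h : L2 Ω ℝ, HasWeakDiv w h ∧
    ∃ φ : ℕ → 𝓓(Ω, Vec d),
      TestTendsto (Ω := Ω) 2 (fun n => φ n) w ∧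
      TestTendsto (Ω := Ω) 2 (fun n => divergence (φ n)) h

/-- `J ∈ H₀(curl, Ω)`, `Ω ⊆ ℝ³`: `curl J ∈ L²` and `J × n = 0` on `∂Ω`. -/
def TangentialTraceZero3 {Ω : Opens (Vec 3)} (J : L2 Ω (Vec 3)) : Prop :=
  ∃ K : L2 Ω (Vec 3), HasWeakCurl3 J K ∧
    ∃ φ : ℕ → 𝓓(Ω, Vec 3),
      TestTendsto (Ω := Ω) 2 (fun n => φ n) J ∧
      TestTendsto (Ω := Ω) 2 (fun n => curl3 (φ n)) K

/-- The planar analogue for a scalar `J`: the vector curl of `J` is in `L²` and `J × n = 0`, that is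
`J = 0`, on `∂Ω`. As `|vcurl2 J| = |∇J|`, this says `J ∈ H¹₀(Ω)`. -/
def TangentialTraceZero2 {Ω : Opens (Vec 2)} (J : L2 Ω ℝ) : Prop :=
  ∃ K : L2 Ω (Vec 2),
    (∀ φ : 𝓓(Ω, Vec 2),
      ∫ x, inner ℝ (K x) (φ x) ∂(vol Ω) = ∫ x, J x * curl2 φ x ∂(vol Ω)) ∧
    ∃ ψ : ℕ → 𝓓(Ω, ℝ),
      TestTendsto (Ω := Ω) 2 (fun n => ψ n) J ∧
      TestTendsto (Ω := Ω) 2 (fun n => vcurl2 (ψ n)) K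

/-! ### Solutions of the dynamical incompressible MHD equations -/

/-- `(u, p, B)` solves the three-dimensional dynamical incompressible MHD equations at the times
`t ∈ I`, with the boundary conditions `u = 0`, `B · n = 0`, `curl B × n = 0`.
Here `Du t i = ∂ᵢ u(t)` and `J t = curl B(t)`, the time derivatives are taken in `L²(Ω)`, and the
momentum and induction equations hold in the sense of distributions on `Ω`. -/
structure IsSolution3 (Ω : Opens (Vec 3)) (Re Rm Sc : ℝ) (f : ℝ → L2 Ω (Vec 3)) (I : Set ℝ)
    (u : ℝ → L2 Ω (Vec 3)) (Du : ℝ → Fin 3 → L2 Ω (Vec 3)) (p : ℝ → L2 Ω ℝ)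
    (B J : ℝ → L2 Ω (Vec 3)) : Prop where
  differentiable_u : ∀ t ∈ I, DifferentiableAt ℝ u t
  differentiable_B : ∀ t ∈ I, DifferentiableAt ℝ B t
  bounded_u : ∀ t ∈ I, MemLp (u t) ⊤ (vol Ω)
  integrable_B : ∀ t ∈ I, MemLp (B t) 3 (vol Ω)
  curl_B : ∀ t ∈ I, HasWeakCurl3 (B t) (J t)
  boundary_u : ∀ t ∈ I, ZeroOnBoundary (u t) (Du t)
  boundary_B : ∀ t ∈ I, NormalTraceZero (B t)
  boundary_curl_B : ∀ t ∈ I, TangentialTraceZero3 (J t)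
  div_u : ∀ t ∈ I, HasWeakDiv (u t) 0
  div_B : ∀ t ∈ I, HasWeakDiv (B t) 0
  /-- `∂ₜu - (1/Re) Δu + (u·∇)u + ∇p - Sc curl B × B = f` -/
  momentum : ∀ t ∈ I, ∀ φ : 𝓓(Ω, Vec 3),
    ∫ x, inner ℝ (deriv u t x) (φ x) ∂(vol Ω)
      + 1 / Re * ∑ i, ∫ x, inner ℝ (Du t i x) (pd i φ x) ∂(vol Ω)
      + ∫ x, inner ℝ (advect (u t x) fun i => Du t i x) (φ x) ∂(vol Ω)
      - ∫ x, p t x * divergence φ x ∂(vol Ω)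
      - Sc * ∫ x, inner ℝ (cross3 (J t x) (B t x)) (φ x) ∂(vol Ω)
    = ∫ x, inner ℝ (f t x) (φ x) ∂(vol Ω)
  /-- `∂ₜB + (Sc/Rm) curl (curl B) - Sc curl (u × B) = 0` -/
  induction_eq : ∀ t ∈ I, ∀ φ : 𝓓(Ω, Vec 3),
    ∫ x, inner ℝ (deriv B t x) (φ x) ∂(vol Ω)
      + Sc / Rm * ∫ x, inner ℝ (J t x) (curl3 φ x) ∂(vol Ω)
      - Sc * ∫ x, inner ℝ (cross3 (u t x) (B t x)) (curl3 φ x) ∂(vol Ω)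
    = 0

/-- The two-dimensional system: as `IsSolution3`, where `curl B`, `u × B` are scalars and
the outer curl of the induction equation is the vector curl. -/
structure IsSolution2 (Ω : Opens (Vec 2)) (Re Rm Sc : ℝ) (f : ℝ → L2 Ω (Vec 2)) (I : Set ℝ)
    (u : ℝ → L2 Ω (Vec 2)) (Du : ℝ → Fin 2 → L2 Ω (Vec 2)) (p : ℝ → L2 Ω ℝ)
    (B : ℝ → L2 Ω (Vec 2)) (J : ℝ → L2 Ω ℝ) : Prop where
  differentiable_u : ∀ t ∈ I, DifferentiableAt ℝ u t
  differentiable_B : ∀ t ∈ I, DifferentiableAt ℝ B t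
  bounded_u : ∀ t ∈ I, MemLp (u t) ⊤ (vol Ω)
  integrable_B : ∀ t ∈ I, MemLp (B t) 3 (vol Ω)
  curl_B : ∀ t ∈ I, HasWeakCurl2 (B t) (J t)
  boundary_u : ∀ t ∈ I, ZeroOnBoundary (u t) (Du t)
  boundary_B : ∀ t ∈ I, NormalTraceZero (B t)
  boundary_curl_B : ∀ t ∈ I, TangentialTraceZero2 (J t)
  div_u : ∀ t ∈ I, HasWeakDiv (u t) 0
  div_B : ∀ t ∈ I, HasWeakDiv (B t) 0
  /-- `∂ₜu - (1/Re) Δu + (u·∇)u + ∇p - Sc curl B × B = f` -/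
  momentum : ∀ t ∈ I, ∀ φ : 𝓓(Ω, Vec 2),
    ∫ x, inner ℝ (deriv u t x) (φ x) ∂(vol Ω)
      + 1 / Re * ∑ i, ∫ x, inner ℝ (Du t i x) (pd i φ x) ∂(vol Ω)
      + ∫ x, inner ℝ (advect (u t x) fun i => Du t i x) (φ x) ∂(vol Ω)
      - ∫ x, p t x * divergence φ x ∂(vol Ω)
      - Sc * ∫ x, inner ℝ (scross2 (J t x) (B t x)) (φ x) ∂(vol Ω)
    = ∫ x, inner ℝ (f t x) (φ x) ∂(vol Ω)
  /-- `∂ₜB + (Sc/Rm) curl (curl B) - Sc curl (u × B) = 0` -/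
  induction_eq : ∀ t ∈ I, ∀ φ : 𝓓(Ω, Vec 2),
    ∫ x, inner ℝ (deriv B t x) (φ x) ∂(vol Ω)
      + Sc / Rm * ∫ x, J t x * curl2 φ x ∂(vol Ω)
      - Sc * ∫ x, cross2 (u t x) (B t x) * curl2 φ x ∂(vol Ω)
    = 0

/-- The squared `L²(Ω)` norm of `∇u`, from the partial derivatives `Du i = ∂ᵢ u`. -/
def gradNormSq {d : ℕ} {Ω : Opens (Vec d)} (Du : Fin d → L2 Ω (Vec d)) : ℝ :=
  ∑ i, ‖Du i‖ ^ 2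

end

end MHD

/-!
The energy identity is obtained by testing the momentum equation with `u` and the induction equation
with `B`. Neither field is a test function, and for `B` no approximation by test functions in the
norm of the curl is available, as its tangential trace need not vanish. Both dimensions are treated
together: all that matters about the cross product is contained in `SkewProduct`.

*Momentum equation* (`ZeroOnBoundary.momentum_balance`). Since `u` is bounded, a smooth truncation
turns the test functions approximating `u` in `W^{1,3}` into uniformly bounded ones
(`ZeroOnBoundary.exists_approximates_comp`), which may be paired with the merely integrable Lorentz
force. The transport term vanishes because `½ |u|²` is itself a limit of test functions and `u` is
divergence free, the pressure term because `div u` is the sum of the diagonal weak derivatives.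

*Induction equation* (`SkewProduct.magnetic_balance`). As `curl B` vanishes tangentially on the
boundary, `∫ |curl B|² = ∫ curl (curl B) · B`. By the equation, `M = curl (u × B)` is then in `L²`,
and the point is `∫ M · B = ∫ (u × B) · curl B` (`SkewProduct.integral_curl_mul`), on an arbitrary
bounded open set. Mollifying `θ B` gives, for test functions `θ`,
`∫ θ M · B = ∫ θ (u × B) · curl B + ∫ (u × B) · (∇θ × B)` (`SkewProduct.integral_curl_mul_test`).
Instead of cutoffs in terms of the distance to the boundary, which would call for a Hardy
inequality, the weight `θ h(u)` is used, where `h` vanishes near `0`: approximating `u` shows it to be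
admissible, even for `θ = 1`. Let `h` tend to the indicator of the complement of `0` with `|y| |Dh(y)|`
bounded. The terms with `Dh(u)` are dominated by the integrable `|B|² |∇u|` and tend to zero
pointwise, so they disappear (`SkewProduct.integral_curl_mul_ne_zero`). With `θ = 1` this is the
claim on `{u ≠ 0}`; comparison with the identity for test functions `θ` shows that `M · B = 0` almost
everywhere on `{u = 0}`.

In the sum of the two balances the Lorentz force and the electromotive force cancel, since
`(curl B × B) · u = -(u × B) · curl B`.
-/

namespace MHD

open scoped ENNReal NNReal

/-! ### Convergence of integrals -/

section Convergence

variable {α : Type*} [MeasurableSpace α] {μ : Measure α}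
  {V W : Type*} [NormedAddCommGroup V] [NormedAddCommGroup W]

theorem one_le_three_div_two : (1 : ℝ≥0∞) ≤ 3 / 2 := by
  rw [ENNReal.le_div_iff_mul_le (by simp) (by simp)]
  norm_num

instance holderTriple_three_three : ENNReal.HolderTriple 3 3 (3 / 2) where
  inv_add_inv_eq_inv := by
    rw [← ENNReal.toReal_eq_toReal_iff' (by simp) (by simp)]
    rw [ENNReal.toReal_add (by simp) (by simp)]
    simp only [ENNReal.toReal_inv, ENNReal.toReal_div, ENNReal.toReal_ofNat]
    norm_num

instance holderTriple_threeHalves_three : ENNReal.HolderTriple (3 / 2) 3 1 where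
  inv_add_inv_eq_inv := by
    rw [← ENNReal.toReal_eq_toReal_iff' (by simp) (by simp)]
    rw [ENNReal.toReal_add (by simp) (by simp)]
    simp only [ENNReal.toReal_inv, ENNReal.toReal_div, ENNReal.toReal_ofNat]
    norm_num

theorem memLp_inner_of_holder [InnerProductSpace ℝ V] {p q r : ℝ≥0∞} [ENNReal.HolderTriple p q r]
    {f g : α → V} (hf : MemLp f p μ) (hg : MemLp g q μ) :
    MemLp (fun x => inner ℝ (f x) (g x)) r μ := by
  refine ⟨hf.1.inner hg.1, ?_⟩
  refine (eLpNorm_le_eLpNorm_mul_eLpNorm_of_nnnorm hf.1 hg.1 (fun a b => inner ℝ a b) 1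
    (Eventually.of_forall fun x => ?_) (p := p) (q := q)).trans_lt ?_
  · simpa using nnnorm_inner_le_nnnorm (𝕜 := ℝ) (f x) (g x)
  · exact ENNReal.mul_lt_top (ENNReal.mul_lt_top (by simp) hf.2) hg.2

theorem tendsto_integral_inner [InnerProductSpace ℝ V] {p q : ℝ≥0∞} [ENNReal.HolderTriple p q 1]
    {g : α → V} {f : ℕ → α → V} {f₀ : α → V} (hg : MemLp g p μ)
    (hf : ∀ n, MemLp (f n) q μ) (hf₀ : MemLp f₀ q μ)
    (h : Tendsto (fun n => eLpNorm (fun x => f n x - f₀ x) q μ) atTop (𝓝 0)) :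
    Tendsto (fun n => ∫ x, inner ℝ (g x) (f n x) ∂μ) atTop (𝓝 (∫ x, inner ℝ (g x) (f₀ x) ∂μ)) := by
  refine tendsto_integral_of_L1' _ (hg.1.inner hf₀.1)
    (Eventually.of_forall fun n => memLp_one_iff_integrable.1 (memLp_inner_of_holder hg (hf n))) ?_
  have key : ∀ n, eLpNorm ((fun x => inner ℝ (g x) (f n x)) - fun x => inner ℝ (g x) (f₀ x)) 1 μ
      ≤ eLpNorm g p μ * eLpNorm (fun x => f n x - f₀ x) q μ := fun n => by
    have := eLpNorm_le_eLpNorm_mul_eLpNorm_of_nnnorm (r := 1) (p := p) (q := q) hg.1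
      ((hf n).1.sub hf₀.1) (fun a b => inner ℝ a b) 1
      (Eventually.of_forall fun x => by
        simpa using nnnorm_inner_le_nnnorm (𝕜 := ℝ) (g x) (f n x - f₀ x))
    simpa [inner_sub_right, Pi.sub_def] using this
  refine tendsto_of_tendsto_of_tendsto_of_le_of_le tendsto_const_nhds ?_ (fun _ => zero_le) key
  simpa using ENNReal.Tendsto.const_mul (a := eLpNorm g p μ) h (Or.inr hg.2.ne)

/-- Dominated convergence in `L^p`. -/
theorem tendsto_eLpNorm_of_dominated {p : ℝ≥0∞} (hp0 : p ≠ 0) (hp : p ≠ ∞) {f : ℕ → α → V}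
    {g : α → W} (hf : ∀ n, AEStronglyMeasurable (f n) μ) (hg : MemLp g p μ)
    (hle : ∀ n, ∀ᵐ x ∂μ, ‖f n x‖ ≤ ‖g x‖)
    (h : ∀ᵐ x ∂μ, Tendsto (fun n => f n x) atTop (𝓝 0)) :
    Tendsto (fun n => eLpNorm (f n) p μ) atTop (𝓝 0) := by
  have hpos : 0 < p.toReal := ENNReal.toReal_pos hp0 hp
  have key : Tendsto (fun n => ∫⁻ x, ‖f n x‖ₑ ^ p.toReal ∂μ) atTop (𝓝 (∫⁻ _, 0 ∂μ)) := by
    refine tendsto_lintegral_of_dominated_convergence' (fun x => ‖g x‖ₑ ^ p.toReal)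
      (fun n => (hf n).enorm.pow_const _) (fun n => ?_) ?_ ?_
    · filter_upwards [hle n] with x hx
      gcongr
      exact enorm_le_iff_norm_le.2 hx
    · exact (lintegral_rpow_enorm_lt_top_of_eLpNorm_lt_top hp0 hp hg.2).ne
    · filter_upwards [h] with x hx
      have h1 := (continuous_enorm.tendsto (0 : V)).comp hx
      have h2 := ((ENNReal.continuous_rpow_const (y := p.toReal)).tendsto _).comp h1
      simpa [Function.comp_def, ENNReal.zero_rpow_of_pos hpos] using h2
  simp_rw [eLpNorm_eq_lintegral_rpow_enorm_toReal hp0 hp]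
  have h3 := ((ENNReal.continuous_rpow_const (y := 1 / p.toReal)).tendsto _).comp key
  simpa [Function.comp_def, ENNReal.zero_rpow_of_pos (inv_pos.2 hpos)] using h3

theorem tendsto_eLpNorm_of_exponent_le [IsFiniteMeasure μ] {p q : ℝ≥0∞} (hp0 : p ≠ 0) (hpq : p ≤ q)
    {f : ℕ → α → V} (hf : ∀ n, AEStronglyMeasurable (f n) μ)
    (h : Tendsto (fun n => eLpNorm (f n) q μ) atTop (𝓝 0)) :
    Tendsto (fun n => eLpNorm (f n) p μ) atTop (𝓝 0) := by
  refine tendsto_of_tendsto_of_tendsto_of_le_of_le tendsto_const_nhds ?_ (fun _ => zero_le)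
    fun n => eLpNorm_le_eLpNorm_mul_rpow_measure_univ hpq (hf n)
  rcases eq_or_ne p ∞ with rfl | hp
  · obtain rfl := top_le_iff.1 hpq
    simpa using h
  have hc : μ Set.univ ^ (1 / p.toReal - 1 / q.toReal) ≠ ∞ := by
    refine ENNReal.rpow_ne_top_of_nonneg ?_ (measure_ne_top _ _)
    rcases eq_or_ne q ∞ with rfl | hq
    · simp
    · exact sub_nonneg.2 (one_div_le_one_div_of_le (ENNReal.toReal_pos hp0 hp)
        (ENNReal.toReal_mono hq hpq))
  simpa using ENNReal.Tendsto.mul_const h (Or.inr hc)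

/-- A bounded sequence converging almost everywhere may be paired with any integrable function. -/
theorem tendsto_integral_inner_of_bounded [InnerProductSpace ℝ V] {g : α → V} {f : ℕ → α → V}
    {f₀ : α → V} {C : ℝ} (hg : Integrable g μ) (hf : ∀ n, AEStronglyMeasurable (f n) μ)
    (hC : ∀ n x, ‖f n x‖ ≤ C) (h : ∀ᵐ x ∂μ, Tendsto (fun n => f n x) atTop (𝓝 (f₀ x))) :
    Tendsto (fun n => ∫ x, inner ℝ (g x) (f n x) ∂μ) atTop (𝓝 (∫ x, inner ℝ (g x) (f₀ x) ∂μ)) := by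
  refine tendsto_integral_of_dominated_convergence (fun x => ‖g x‖ * C)
    (fun n => hg.1.inner (hf n)) (hg.norm.mul_const C) (fun n => Eventually.of_forall fun x => ?_) ?_
  · exact (norm_inner_le_norm _ _).trans (by gcongr; exact hC n x)
  · filter_upwards [h] with x hx using tendsto_const_nhds.inner hx

end Convergence

/-! ### Test functions -/

section TestFunctions

variable {d : ℕ} {Ω : Opens (Vec d)}
  {V W : Type} [NormedAddCommGroup V] [NormedSpace ℝ V] [NormedAddCommGroup W] [NormedSpace ℝ W]

/-- The test function `h ∘ φ`, for a smooth `h` with `h 0 = 0`. -/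
noncomputable def compTest (h : V → W) (hh : ContDiff ℝ (⊤ : ℕ∞) h) (h0 : h 0 = 0)
    (φ : 𝓓(Ω, V)) : 𝓓(Ω, W) where
  toFun x := h (φ x)
  contDiff' := hh.comp φ.contDiff
  hasCompactSupport' := φ.hasCompactSupport.comp_left h0
  tsupport_subset' := (closure_mono (Function.support_comp_subset h0 φ)).trans φ.tsupport_subset

@[simp] theorem compTest_apply (h : V → W) (hh : ContDiff ℝ (⊤ : ℕ∞) h) (h0 : h 0 = 0)
    (φ : 𝓓(Ω, V)) (x : Vec d) : compTest h hh h0 φ x = h (φ x) := rfl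

/-- The test function `θ • φ`, for a smooth `θ`. -/
noncomputable def smulTest (θ : Vec d → ℝ) (hθ : ContDiff ℝ (⊤ : ℕ∞) θ) (φ : 𝓓(Ω, V)) :
    𝓓(Ω, V) where
  toFun x := θ x • φ x
  contDiff' := hθ.smul φ.contDiff
  hasCompactSupport' := φ.hasCompactSupport.smul_left
  tsupport_subset' := (tsupport_smul_subset_right _ _).trans φ.tsupport_subset

@[simp] theorem smulTest_apply (θ : Vec d → ℝ) (hθ : ContDiff ℝ (⊤ : ℕ∞) θ) (φ : 𝓓(Ω, V))
    (x : Vec d) : smulTest θ hθ φ x = θ x • φ x := rfl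

theorem differentiable_test (φ : 𝓓(Ω, V)) : Differentiable ℝ φ :=
  φ.contDiff.differentiable (by simp)

theorem pd_comp (i : Fin d) {h : V → W} (hh : Differentiable ℝ h) {φ : Vec d → V}
    (hφ : Differentiable ℝ φ) (x : Vec d) :
    pd i (fun y => h (φ y)) x = fderiv ℝ h (φ x) (pd i φ x) := by
  have := fderiv_comp x (hh (φ x)) (hφ x)
  simp only [pd, Function.comp_def] at *
  rw [this]; rfl

theorem pd_smul (i : Fin d) {θ : Vec d → ℝ} (hθ : Differentiable ℝ θ) {φ : Vec d → V}
    (hφ : Differentiable ℝ φ) (x : Vec d) :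
    pd i (fun y => θ y • φ y) x = θ x • pd i φ x + pd i θ x • φ x := by
  simp only [pd]
  rw [fderiv_fun_smul (hθ x) (hφ x)]
  simp

theorem continuous_pd (i : Fin d) {φ : Vec d → V} (hφ : ContDiff ℝ (⊤ : ℕ∞) φ) :
    Continuous (pd i φ) :=
  (hφ.continuous_fderiv (by simp)).clm_apply continuous_const

theorem hasCompactSupport_pd (i : Fin d) {φ : Vec d → V} (hφ : HasCompactSupport φ) :
    HasCompactSupport (pd i φ) :=
  (hφ.fderiv (𝕜 := ℝ)).comp_left (g := fun T : Vec d →L[ℝ] V => T (EuclideanSpace.single i 1)) rfl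

theorem memLp_test (φ : 𝓓(Ω, V)) (p : ℝ≥0∞) : MemLp φ p (vol Ω) :=
  (φ.continuous.memLp_of_hasCompactSupport φ.hasCompactSupport)

theorem memLp_pd_test (i : Fin d) (φ : 𝓓(Ω, V)) (p : ℝ≥0∞) : MemLp (pd i φ) p (vol Ω) :=
  ((continuous_pd i φ.contDiff).memLp_of_hasCompactSupport
    (hasCompactSupport_pd i φ.hasCompactSupport))

/-- A function that is integrable on `Ω` and orthogonal to all test functions vanishes. -/
theorem ae_eq_zero_of_forall_test {f : Vec d → ℝ} (hf : Integrable f (vol Ω))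
    (h : ∀ ψ : 𝓓(Ω, ℝ), ∫ x, ψ x * f x ∂(vol Ω) = 0) : f =ᵐ[vol Ω] 0 := by
  have hΩ := Ω.isOpen
  refine (ae_restrict_iff' hΩ.measurableSet).2
    (hΩ.ae_eq_zero_of_integral_contDiff_smul_eq_zero
      (IntegrableOn.locallyIntegrableOn hf) fun g hg hgc hgs => ?_)
  rw [← setIntegral_eq_integral_of_forall_compl_eq_zero (s := (Ω : Set (Vec d)))]
  · exact h ⟨g, hg, hgc, hgs⟩
  · intro x hx
    rw [image_eq_zero_of_notMem_tsupport fun hx' => hx (hgs hx'), zero_smul]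

end TestFunctions

/-! ### Approximation of fields vanishing on the boundary -/

section Approximation

variable {d : ℕ} {Ω : Opens (Vec d)}
  {W : Type} [NormedAddCommGroup W] [NormedSpace ℝ W]

/-- The test functions `φ n` approximate `u ∈ W^{1,3}_0(Ω)` almost everywhere, and their partial
derivatives approximate the partial derivatives `Du i` of `u` in `L³`. -/
structure Approximates (φ : ℕ → 𝓓(Ω, W)) (u : Vec d → W) (Du : Fin d → Vec d → W) : Prop where
  ae_tendsto : ∀ᵐ x ∂(vol Ω), Tendsto (fun n => φ n x) atTop (𝓝 (u x))
  memLp_deriv : ∀ i, MemLp (Du i) 3 (vol Ω)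
  tendsto_pd : ∀ i, TestTendsto (Ω := Ω) 3 (fun n => pd i (φ n)) (Du i)

theorem ZeroOnBoundary.exists_approximates {u : L2 Ω (Vec d)} {Du : Fin d → L2 Ω (Vec d)}
    (h : ZeroOnBoundary u Du) :
    ∃ φ : ℕ → 𝓓(Ω, Vec d), Approximates φ u (fun i => Du i) := by
  obtain ⟨hu, hDu, -, φ, hφ, hdφ⟩ := h
  obtain ⟨ns, hns, hae⟩ := (tendstoInMeasure_of_tendsto_eLpNorm (p := 3) (by simp)
    (fun n => (memLp_test (φ n) 3).1) hu.1 hφ).exists_seq_tendsto_ae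
  exact ⟨fun n => φ (ns n), hae, hDu, fun i => (hdφ i).comp hns.tendsto_atTop⟩

/-- The chain rule `∂ᵢ (h ∘ u) = Dh(u) ∂ᵢ u`, at the level of approximations. -/
theorem Approximates.comp {V : Type} [NormedAddCommGroup V] [NormedSpace ℝ V]
    {φ : ℕ → 𝓓(Ω, V)} {u : Vec d → V} {Du : Fin d → Vec d → V}
    (hφ : Approximates φ u Du) (hu : AEStronglyMeasurable u (vol Ω))
    {h : V → W} (hh : ContDiff ℝ (⊤ : ℕ∞) h) (h0 : h 0 = 0) {C : ℝ}
    (hC : ∀ y, ‖fderiv ℝ h y‖ ≤ C) :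
    Approximates (fun n => compTest h hh h0 (φ n)) (fun x => h (u x))
      (fun i x => fderiv ℝ h (u x) (Du i x)) := by
  have hC0 : 0 ≤ C := (norm_nonneg _).trans (hC 0)
  have hcont : Continuous fun y => fderiv ℝ h y := hh.continuous_fderiv (by simp)
  have hmeas : ∀ i, AEStronglyMeasurable (fun x => fderiv ℝ h (u x) (Du i x)) (vol Ω) := fun i =>
    (ContinuousLinearMap.apply ℝ W).flip.aestronglyMeasurable_comp₂
      (hcont.comp_aestronglyMeasurable hu) (hφ.memLp_deriv i).1
  have hmeas' : ∀ i n, AEStronglyMeasurable (fun x => fderiv ℝ h (φ n x) (Du i x)) (vol Ω) :=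
    fun i n => (ContinuousLinearMap.apply ℝ W).flip.aestronglyMeasurable_comp₂
      (hcont.comp_aestronglyMeasurable (φ n).continuous.aestronglyMeasurable) (hφ.memLp_deriv i).1
  have hmem : ∀ i, MemLp (fun x => fderiv ℝ h (u x) (Du i x)) 3 (vol Ω) := fun i =>
    (hφ.memLp_deriv i).of_le_mul (hmeas i)
      (Eventually.of_forall fun x => (fderiv ℝ h (u x)).le_of_opNorm_le (hC _) _)
  refine ⟨?_, hmem, fun i => ?_⟩
  · filter_upwards [hφ.ae_tendsto] with x hx using (hh.continuous.tendsto _).comp hx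
  -- `∂ᵢ (h ∘ φₙ) - Dh(u) ∂ᵢ u = Dh(φₙ) (∂ᵢ φₙ - ∂ᵢ u) + (Dh(φₙ) - Dh(u)) ∂ᵢ u`
  have h1 : Tendsto (fun n => eLpNorm
      (fun x => fderiv ℝ h (φ n x) (pd i (φ n) x - Du i x)) 3 (vol Ω)) atTop (𝓝 0) := by
    refine tendsto_of_tendsto_of_tendsto_of_le_of_le tendsto_const_nhds
      (h := fun n => ENNReal.ofReal C * eLpNorm (fun x => pd i (φ n) x - Du i x) 3 (vol Ω))
      ?_ (fun _ => zero_le) fun n => ?_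
    · simpa using ENNReal.Tendsto.const_mul (hφ.tendsto_pd i) (Or.inr ENNReal.ofReal_ne_top)
    · exact eLpNorm_le_mul_eLpNorm_of_ae_le_mul
        (Eventually.of_forall fun x => (fderiv ℝ h (φ n x)).le_of_opNorm_le (hC _) _) 3
  have h2 : Tendsto (fun n => eLpNorm
      (fun x => fderiv ℝ h (φ n x) (Du i x) - fderiv ℝ h (u x) (Du i x)) 3 (vol Ω))
      atTop (𝓝 0) := by
    refine tendsto_eLpNorm_of_dominated (by simp) (by simp)
      (fun n => (hmeas' i n).sub (hmeas i))
      ((hφ.memLp_deriv i).const_smul (2 * C)) (fun n => Eventually.of_forall fun x => ?_) ?_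
    · have a := (fderiv ℝ h (φ n x)).le_of_opNorm_le (hC _) (Du i x)
      have b := (fderiv ℝ h (u x)).le_of_opNorm_le (hC _) (Du i x)
      refine (norm_sub_le _ _).trans ?_
      simp only [Pi.smul_apply, norm_smul, Real.norm_eq_abs,
        abs_of_nonneg (show 0 ≤ 2 * C by linarith)]
      linarith
    · filter_upwards [hφ.ae_tendsto] with x hx
      have := ((hcont.clm_apply (continuous_const (y := Du i x))).tendsto _).comp hx
      simpa using this.sub_const (fderiv ℝ h (u x) (Du i x))
  have h3 := h1.add h2
  rw [add_zero] at h3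
  refine tendsto_of_tendsto_of_tendsto_of_le_of_le tendsto_const_nhds h3 (fun _ => zero_le)
    fun n => ?_
  have hm1 : AEStronglyMeasurable (fun x => fderiv ℝ h (φ n x) (pd i (φ n) x - Du i x)) (vol Ω) :=
    (ContinuousLinearMap.apply ℝ W).flip.aestronglyMeasurable_comp₂
      (hcont.comp_aestronglyMeasurable (φ n).continuous.aestronglyMeasurable)
      ((memLp_pd_test i (φ n) 3).1.sub (hφ.memLp_deriv i).1)
  refine le_trans (le_of_eq ?_) (eLpNorm_add_le hm1 ((hmeas' i n).sub (hmeas i)) (by norm_num))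
  congr 1
  ext x
  have : pd i (compTest h hh h0 (φ n)) x = fderiv ℝ h (φ n x) (pd i (φ n) x) :=
    pd_comp i (hh.differentiable (by simp)) (differentiable_test _) x
  simp [this]

/-- A smooth function on `ℝ^d` with compact support has a bounded derivative. -/
theorem exists_norm_fderiv_le {h : Vec d → W} (hh : ContDiff ℝ (⊤ : ℕ∞) h)
    (hs : HasCompactSupport h) : ∃ C, ∀ y, ‖fderiv ℝ h y‖ ≤ C :=
  (hh.continuous_fderiv (by simp)).bounded_above_of_compact_support (hs.fderiv (𝕜 := ℝ))

/-- A globally smooth function `h` may be modified outside of a large ball so as to become compactly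
supported; composition with the bounded function `u` does not see the modification. -/
theorem exists_truncation {h : Vec d → W} (hh : ContDiff ℝ (⊤ : ℕ∞) h) (R : ℝ) :
    ∃ k : Vec d → W, ContDiff ℝ (⊤ : ℕ∞) k ∧ HasCompactSupport k ∧ (h 0 = 0 → k 0 = 0) ∧
      ∀ y, ‖y‖ ≤ R → k y = h y ∧ fderiv ℝ k y = fderiv ℝ h y := by
  let b : ContDiffBump (0 : Vec d) := ⟨|R| + 1, |R| + 2, by positivity, by linarith⟩
  refine ⟨fun y => b y • h y, b.contDiff.smul hh, b.hasCompactSupport.smul_right,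
    fun h0 => by simp [h0], fun y hy => ?_⟩
  have hev : (fun y => b y • h y) =ᶠ[𝓝 y] h := by
    have : Metric.ball (0 : Vec d) (|R| + 1) ∈ 𝓝 y :=
      Metric.isOpen_ball.mem_nhds (by
        rw [mem_ball_zero_iff]; linarith [le_abs_self R])
    filter_upwards [this] with z hz
    rw [b.one_of_mem_closedBall (Metric.ball_subset_closedBall hz), one_smul]
  exact ⟨hev.self_of_nhds, hev.fderiv_eq⟩

theorem exists_ae_norm_le {V : Type} [NormedAddCommGroup V] {u : Vec d → V}
    (h : MemLp u ⊤ (vol Ω)) : ∃ R : ℝ, ∀ᵐ x ∂(vol Ω), ‖u x‖ ≤ R := by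
  have h2 := h.2
  rw [eLpNorm_exponent_top] at h2
  refine ⟨(eLpNormEssSup u (vol Ω)).toReal, ?_⟩
  filter_upwards [enorm_ae_le_eLpNormEssSup u (vol Ω)] with x hx
  rw [← toReal_enorm]
  exact ENNReal.toReal_mono h2.ne hx

/-- If `u` is bounded and `h` is smooth with `h 0 = 0`, then `h ∘ u` is approximated by uniformly
bounded test functions, and the chain rule holds in the limit. -/
theorem ZeroOnBoundary.exists_approximates_comp {u : L2 Ω (Vec d)} {Du : Fin d → L2 Ω (Vec d)}
    (hu : ZeroOnBoundary u Du) (hb : MemLp u ⊤ (vol Ω)) {h : Vec d → W}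
    (hh : ContDiff ℝ (⊤ : ℕ∞) h) (h0 : h 0 = 0) :
    ∃ (φ : ℕ → 𝓓(Ω, W)) (C : ℝ), (∀ n x, ‖φ n x‖ ≤ C) ∧
      Approximates φ (fun x => h (u x)) (fun i x => fderiv ℝ h (u x) (Du i x)) := by
  obtain ⟨φ, hφ⟩ := hu.exists_approximates
  obtain ⟨R, hR⟩ := exists_ae_norm_le hb
  obtain ⟨k, hk, hks, hk0, hkh⟩ := exists_truncation hh R
  obtain ⟨C, hC⟩ := exists_norm_fderiv_le hk hks
  obtain ⟨C', hC'⟩ := hk.continuous.bounded_above_of_compact_support hks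
  have hA := hφ.comp hb.1 hk (hk0 h0) hC
  have hae : ∀ i, (fun x => fderiv ℝ k (u x) (Du i x)) =ᵐ[vol Ω]
      fun x => fderiv ℝ h (u x) (Du i x) := fun i => by
    filter_upwards [hR] with x hx
    rw [(hkh _ hx).2]
  refine ⟨fun n => compTest k hk (hk0 h0) (φ n), C', fun n x => hC' (φ n x), ?_, fun i =>
    (hA.memLp_deriv i).ae_eq (hae i), fun i => (hA.tendsto_pd i).congr fun n =>
      eLpNorm_congr_ae ?_⟩
  · filter_upwards [hA.ae_tendsto, hR] with x hx hx'
    rwa [← (hkh _ hx').1]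
  · filter_upwards [hae i] with x hx
    rw [hx]

end Approximation

/-! ### The momentum equation tested with the velocity -/

section Momentum

variable {d : ℕ} {Ω : Opens (Vec d)}

theorem memLp_apply {μ : Measure (Vec d)} {p : ℝ≥0∞} {w : Vec d → Vec d} (hw : MemLp w p μ)
    (i : Fin d) : MemLp (fun x => w x i) p μ :=
  hw.continuousLinearMap_comp (EuclideanSpace.proj i : Vec d →L[ℝ] ℝ)

theorem Approximates.tendsto_integral_inner_pd [IsFiniteMeasure (vol Ω)] {V : Type}
    [NormedAddCommGroup V] [InnerProductSpace ℝ V] {φ : ℕ → 𝓓(Ω, V)} {u : Vec d → V}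
    {Du : Fin d → Vec d → V} (hφ : Approximates φ u Du) {g : Vec d → V}
    (hg : MemLp g 2 (vol Ω)) (i : Fin d) :
    Tendsto (fun n => ∫ x, inner ℝ (g x) (pd i (φ n) x) ∂(vol Ω)) atTop
      (𝓝 (∫ x, inner ℝ (g x) (Du i x) ∂(vol Ω))) := by
  have h23 : (2 : ℝ≥0∞) ≤ 3 := by norm_num
  exact tendsto_integral_inner (p := 2) (q := 2) hg (fun n => memLp_pd_test i (φ n) 2)
    ((hφ.memLp_deriv i).mono_exponent h23)
    (tendsto_eLpNorm_of_exponent_le (by simp) h23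
      (fun n => (memLp_pd_test i (φ n) 3).1.sub (hφ.memLp_deriv i).1) (hφ.tendsto_pd i))

theorem HasWeakDiv.sum_integral_eq_zero {u : L2 Ω (Vec d)} (h : HasWeakDiv u 0) (ψ : 𝓓(Ω, ℝ)) :
    ∑ i, ∫ x, u x i * pd i ψ x ∂(vol Ω) = 0 := by
  have h1 := h ψ
  have h2 : ∫ x, (0 : L2 Ω ℝ) x * ψ x ∂(vol Ω) = 0 := by
    refine integral_eq_zero_of_ae ?_
    filter_upwards [Lp.coeFn_zero ℝ 2 (vol Ω)] with x hx
    exact mul_eq_zero_of_left hx _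
  rw [h2, eq_comm, neg_eq_zero] at h1
  rw [← integral_finsetSum, ← h1]
  · simp [grad, PiLp.inner_apply, mul_comm]
  · intro i _
    exact (memLp_apply (Lp.memLp u) i).integrable_mul (memLp_pd_test i ψ 2)

theorem integrable_smul_deriv {u : L2 Ω (Vec d)} {Du : Fin d → L2 Ω (Vec d)} (i : Fin d) :
    Integrable (fun x => u x i • Du i x) (vol Ω) :=
  memLp_one_iff_integrable.1 ((Lp.memLp (Du i)).smul (memLp_apply (Lp.memLp u) i))

/-- `∫ (u · ∇u) · u = ½ ∫ u · ∇|u|² = 0`, as `½ |u|²` is a limit of test functions and `div u = 0`. -/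
theorem ZeroOnBoundary.integral_advect_eq_zero [IsFiniteMeasure (vol Ω)]
    {u : L2 Ω (Vec d)} {Du : Fin d → L2 Ω (Vec d)}
    (hu : ZeroOnBoundary u Du) (hb : MemLp u ⊤ (vol Ω)) (hdiv : HasWeakDiv u 0) :
    ∫ x, inner ℝ (advect (u x) fun i => Du i x) (u x) ∂(vol Ω) = 0 := by
  have hh : ContDiff ℝ (⊤ : ℕ∞) fun y : Vec d => 1 / 2 * ‖y‖ ^ 2 :=
    contDiff_const.mul (contDiff_norm_sq ℝ)
  have hd : ∀ y v : Vec d, fderiv ℝ (fun y : Vec d => 1 / 2 * ‖y‖ ^ 2) y v = inner ℝ y v := by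
    intro y v
    rw [((hasStrictFDerivAt_norm_sq y).hasFDerivAt.const_mul (1 / 2)).fderiv]
    simp
  obtain ⟨ψ, C, -, hψ⟩ := hu.exists_approximates_comp hb hh (by simp)
  simp only [hd] at hψ
  have lim : Tendsto (fun n => ∑ i, ∫ x, u x i * pd i (ψ n) x ∂(vol Ω)) atTop
      (𝓝 (∑ i, ∫ x, u x i * inner ℝ (u x) (Du i x) ∂(vol Ω))) := by
    refine tendsto_finsetSum _ fun i _ => ?_
    have := hψ.tendsto_integral_inner_pd (memLp_apply (Lp.memLp u) i) i
    simpa [mul_comm] using this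
  simp only [hdiv.sum_integral_eq_zero] at lim
  rw [← tendsto_nhds_unique lim tendsto_const_nhds, ← integral_finsetSum]
  · refine integral_congr_ae (Eventually.of_forall fun x => ?_)
    simp [advect, sum_inner, inner_smul_left, real_inner_comm]
  · intro i _
    exact (memLp_apply (Lp.memLp u) i).integrable_mul
      ((hψ.memLp_deriv i).mono_exponent (by norm_num : (2 : ℝ≥0∞) ≤ 3))

/-- The weak divergence is the sum of the diagonal weak derivatives. -/
theorem ZeroOnBoundary.sum_deriv_eq_zero [IsFiniteMeasure (vol Ω)]
    {u : L2 Ω (Vec d)} {Du : Fin d → L2 Ω (Vec d)}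
    (hu : ZeroOnBoundary u Du) (hdiv : HasWeakDiv u 0) :
    (fun x => ∑ i, Du i x i) =ᵐ[vol Ω] 0 := by
  have hint : ∀ i, MemLp (fun x => Du i x i) 2 (vol Ω) := fun i => memLp_apply (Lp.memLp (Du i)) i
  refine ae_eq_zero_of_forall_test
    (integrable_finsetSum _ fun i _ => (hint i).integrable one_le_two) fun ψ => ?_
  have key : ∀ i, ∫ x, ψ x * Du i x i ∂(vol Ω) = - ∫ x, u x i * pd i ψ x ∂(vol Ω) := fun i => by
    let T : ℝ →L[ℝ] Vec d := ContinuousLinearMap.toSpanSingleton ℝ (EuclideanSpace.single i 1)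
    have h := hu.2.2.1 i (compTest T T.contDiff (map_zero T) ψ)
    have hpd : ∀ x, pd i (compTest T T.contDiff (map_zero T) ψ) x = T (pd i ψ x) := fun x => by
      have := pd_comp i T.differentiable (differentiable_test ψ) x
      rwa [ContinuousLinearMap.fderiv] at this
    simp only [hpd] at h
    simpa [T, inner_smul_right, EuclideanSpace.inner_single_right, mul_comm] using h
  simp_rw [Finset.mul_sum]
  rw [integral_finsetSum]
  · simp only [key, Finset.sum_neg_distrib, hdiv.sum_integral_eq_zero, neg_zero]
  · intro i _
    exact (memLp_test ψ 2).integrable_mul (hint i)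

/-- In the weak momentum equation, the velocity itself may be used as a test function. Here `a` is
the time derivative and `N` the Lorentz force. -/
theorem ZeroOnBoundary.momentum_balance [IsFiniteMeasure (vol Ω)]
    {u : L2 Ω (Vec d)} {Du : Fin d → L2 Ω (Vec d)}
    (hu : ZeroOnBoundary u Du) (hb : MemLp u ⊤ (vol Ω)) (hdiv : HasWeakDiv u 0)
    {a f : L2 Ω (Vec d)} {p : L2 Ω ℝ} {N : Vec d → Vec d} (hN : Integrable N (vol Ω)) {ν s : ℝ}
    (heq : ∀ φ : 𝓓(Ω, Vec d),
      ∫ x, inner ℝ (a x) (φ x) ∂(vol Ω)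
        + ν * ∑ i, ∫ x, inner ℝ (Du i x) (pd i φ x) ∂(vol Ω)
        + ∫ x, inner ℝ (advect (u x) fun i => Du i x) (φ x) ∂(vol Ω)
        - ∫ x, p x * divergence φ x ∂(vol Ω)
        - s * ∫ x, inner ℝ (N x) (φ x) ∂(vol Ω)
      = ∫ x, inner ℝ (f x) (φ x) ∂(vol Ω)) :
    inner ℝ a u + ν * gradNormSq Du - s * ∫ x, inner ℝ (N x) (u x) ∂(vol Ω) = inner ℝ f u := by
  obtain ⟨φ, C, hC, hφ⟩ := hu.exists_approximates_comp hb contDiff_id rfl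
  simp only [fderiv_id, id, ContinuousLinearMap.id_apply] at hφ
  have pair : ∀ {g : Vec d → Vec d}, Integrable g (vol Ω) →
      Tendsto (fun n => ∫ x, inner ℝ (g x) (φ n x) ∂(vol Ω)) atTop
        (𝓝 (∫ x, inner ℝ (g x) (u x) ∂(vol Ω))) := fun hg =>
    tendsto_integral_inner_of_bounded hg (fun n => (φ n).continuous.aestronglyMeasurable) hC
      hφ.ae_tendsto
  have hadv : Integrable (fun x => advect (u x) fun i => Du i x) (vol Ω) :=
    integrable_finsetSum _ fun i _ => integrable_smul_deriv i
  have hvisc : Tendsto (fun n => ∑ i, ∫ x, inner ℝ (Du i x) (pd i (φ n) x) ∂(vol Ω)) atTop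
      (𝓝 (gradNormSq Du)) := by
    refine tendsto_finsetSum _ fun i _ => ?_
    have := hφ.tendsto_integral_inner_pd (Lp.memLp (Du i)) i
    rwa [← L2.inner_def, real_inner_self_eq_norm_sq] at this
  have hpe : ∀ i, MemLp (fun x => p x • (EuclideanSpace.single i 1 : Vec d)) 2 (vol Ω) := fun i =>
    (Lp.memLp p).continuousLinearMap_comp
      (ContinuousLinearMap.toSpanSingleton ℝ (EuclideanSpace.single i 1 : Vec d))
  have hin : ∀ (i : Fin d) (s : ℝ) (v : Vec d),
      inner ℝ (s • (EuclideanSpace.single i 1 : Vec d)) v = s * v i := fun i s v => by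
    rw [inner_smul_left, EuclideanSpace.inner_single_left]; simp
  have hpress : Tendsto (fun n => ∫ x, p x * divergence (φ n) x ∂(vol Ω)) atTop (𝓝 0) := by
    have lim := tendsto_finsetSum Finset.univ fun i _ => hφ.tendsto_integral_inner_pd (hpe i) i
    simp only [hin] at lim
    have e0 : ∑ i, ∫ x, p x * Du i x i ∂(vol Ω) = 0 := by
      rw [← integral_finsetSum]
      · refine integral_eq_zero_of_ae ?_
        filter_upwards [hu.sum_deriv_eq_zero hdiv] with x hx
        rw [← Finset.mul_sum, hx]
        simp
      · exact fun i _ => (Lp.memLp p).integrable_mul (memLp_apply (Lp.memLp (Du i)) i)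
    rw [e0] at lim
    refine lim.congr fun n => ?_
    rw [← integral_finsetSum]
    · simp only [divergence, Finset.mul_sum]
    · exact fun i _ => (Lp.memLp p).integrable_mul (memLp_apply (memLp_pd_test i (φ n) 2) i)
  have lim := ((((pair ((Lp.memLp a).integrable one_le_two)).add (hvisc.const_mul ν)).add
    (pair hadv)).sub hpress).sub ((pair hN).const_mul s)
  simp only [heq] at lim
  have := tendsto_nhds_unique lim (pair ((Lp.memLp f).integrable one_le_two))
  rw [hu.integral_advect_eq_zero hb hdiv] at this
  simpa [L2.inner_def] using this

end Momentum

/-! ### Curl operators of a skew product -/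

/-- A bilinear product `cross : ℝ^d × ℝ^d → G` together with the action of `G` on `ℝ^d` by
skew-symmetric maps which is dual to it. The spatial cross product (`G = ℝ³`) and the planar one
(`G = ℝ`) are both of this form. -/
structure SkewProduct (d : ℕ) (G : Type) [NormedAddCommGroup G] [InnerProductSpace ℝ G] where
  /-- The product of two vectors, as in `u × B`. -/
  cross : Vec d →L[ℝ] Vec d →L[ℝ] G
  /-- The action of `G` on vectors, as in `curl B × B`. -/
  act : G →L[ℝ] Vec d →L[ℝ] Vec d
  act_skew : ∀ j a b, inner ℝ (act j a) b = -inner ℝ a (act j b)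
  inner_cross : ∀ v b j, inner ℝ (cross v b) j = -inner ℝ (act j b) v

/-- The `i`-th standard basis vector. -/
noncomputable abbrev stdVec {d : ℕ} (i : Fin d) : Vec d := EuclideanSpace.single i 1

section Curl

variable {d : ℕ} {Ω : Opens (Vec d)} {G : Type} [NormedAddCommGroup G] [InnerProductSpace ℝ G]

/-- The curl `∑ᵢ eᵢ × ∂ᵢ φ` of a vector field. -/
noncomputable def SkewProduct.curl (S : SkewProduct d G) (φ : Vec d → Vec d) (x : Vec d) : G :=
  ∑ i, S.cross (stdVec i) (pd i φ x)

/-- The formal adjoint of `SkewProduct.curl`. -/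
noncomputable def SkewProduct.cocurl (S : SkewProduct d G) (ψ : Vec d → G) (x : Vec d) : Vec d :=
  -∑ i, S.act (pd i ψ x) (stdVec i)

theorem SkewProduct.inner_act (S : SkewProduct d G) (b v : Vec d) (j : G) :
    inner ℝ b (S.act j v) = inner ℝ (S.cross v b) j := by
  rw [S.inner_cross, S.act_skew, neg_neg]

/-- `M = curl E` on `Ω` in the sense of distributions, for a `G`-valued field `E`. -/
def SkewProduct.HasWeakCurl (S : SkewProduct d G) (Ω : Opens (Vec d)) (E : Vec d → G)
    (M : Vec d → Vec d) : Prop :=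
  ∀ φ : 𝓓(Ω, Vec d),
    ∫ x, inner ℝ (M x) (φ x) ∂(vol Ω) = ∫ x, inner ℝ (E x) (S.curl φ x) ∂(vol Ω)

/-- `J = curl B` on `Ω` in the sense of distributions, for a vector field `B`. -/
def SkewProduct.HasWeakCocurl (S : SkewProduct d G) (Ω : Opens (Vec d)) (B : Vec d → Vec d)
    (J : Vec d → G) : Prop :=
  ∀ ψ : 𝓓(Ω, G),
    ∫ x, inner ℝ (J x) (ψ x) ∂(vol Ω) = ∫ x, inner ℝ (B x) (S.cocurl ψ x) ∂(vol Ω)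

end Curl

/-! ### Integration by parts for two weak curls -/

section Mollification

variable {d : ℕ} {Ω : Opens (Vec d)} {V : Type} [NormedAddCommGroup V] [InnerProductSpace ℝ V]

/-- Translation is continuous in `L²`, hence so is the correlation of two `L²` functions. -/
theorem continuous_correlation {M F : Vec d → V} (hM : MemLp M 2 (vol Ω))
    (hF : MemLp F 2 (volume : Measure (Vec d))) :
    Continuous fun y => ∫ x, inner ℝ (M x) (F (x + y)) ∂(vol Ω) := by
  have hΩ := Ω.isOpen.measurableSet
  have hM' : MemLp ((Ω : Set (Vec d)).indicator M) 2 (volume : Measure (Vec d)) :=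
    (memLp_indicator_iff_restrict hΩ).2 hM
  let g : Vec d → C(Vec d, Vec d) := fun y => ⟨fun x => x + y, continuous_id.add continuous_const⟩
  have hg : Continuous g := ContinuousMap.continuous_of_continuous_uncurry _
    (by exact continuous_snd.add continuous_fst)
  have hgm : ∀ y, MeasurePreserving (g y) (volume : Measure (Vec d)) volume := fun y =>
    measurePreserving_add_right volume y
  have hc := Continuous.compMeasurePreservingLp (f := fun _ : Vec d => hF.toLp F)
    continuous_const hg hgm (by simp)
  refine ((continuous_const (y := hM'.toLp _)).inner (𝕜 := ℝ) hc).congr fun y => ?_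
  rw [L2.inner_def, ← integral_indicator hΩ]
  refine integral_congr_ae ?_
  have h1 := (hgm y).quasiMeasurePreserving.ae_eq_comp hF.coeFn_toLp
  filter_upwards [hM'.coeFn_toLp, Lp.coeFn_compMeasurePreserving (hF.toLp F) (hgm y), h1]
    with x hx hx2 hx3
  rw [hx, hx2, hx3]
  by_cases hxΩ : x ∈ (Ω : Set (Vec d)) <;> simp [hxΩ, g]

theorem integral_inner_mollified [CompleteSpace V] {M F : Vec d → V} (hM : Integrable M (vol Ω))
    (hF : Integrable F (volume : Measure (Vec d))) {ρ : Vec d → ℝ} (hρ : Continuous ρ)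
    (hρs : HasCompactSupport ρ) :
    ∫ x, inner ℝ (M x) (∫ z, ρ (x - z) • F z) ∂(vol Ω) =
      ∫ y, ρ y * ∫ x, inner ℝ (M x) (F (x + (0 - y))) ∂(vol Ω) := by
  obtain ⟨C, hC⟩ := hρ.bounded_above_of_compact_support hρs
  have h1 : ∀ x, inner ℝ (M x) (∫ z, ρ (x - z) • F z) =
      ∫ y, ρ y * inner ℝ (M x) (F (x + (0 - y))) := fun x => by
    rw [← integral_sub_left_eq_self (fun z => ρ (x - z) • F z) volume x, ← integral_inner]
    · simp [inner_smul_right, sub_eq_add_neg]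
    · simp only [sub_sub_cancel]
      exact (hF.comp_sub_left x).bdd_smul C hρ.aestronglyMeasurable
        (Eventually.of_forall hC)
  simp only [h1, ← integral_const_mul]
  refine integral_integral_swap ?_
  have h2 := (Integrable.convolution_integrand (innerSL ℝ) hM
    (hF.comp_neg) (μ := volume)).swap
  refine (h2.bdd_mul (c := C) (f := fun p : Vec d × Vec d => ρ p.2)
    (hρ.comp continuous_snd).aestronglyMeasurable
    (Eventually.of_forall fun p => hC p.2)).congr (Eventually.of_forall fun p => ?_)
  simp only [Function.uncurry, Function.comp_apply, Prod.fst_swap, Prod.snd_swap, zero_sub,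
    neg_sub, ← sub_eq_add_neg]
  rfl

end Mollification

section Green

variable {d : ℕ} {Ω : Opens (Vec d)} {G : Type} [NormedAddCommGroup G] [InnerProductSpace ℝ G]
  [FiniteDimensional ℝ G]

theorem pd_mollified {F : Vec d → Vec d}
    (hF : Integrable F (volume : Measure (Vec d))) {ρ : Vec d → ℝ}
    (hρ : ContDiff ℝ (⊤ : ℕ∞) ρ) (hρs : HasCompactSupport ρ) (i : Fin d) (x : Vec d) :
    pd i (fun x => ∫ z, ρ (x - z) • F z) x = ∫ z, pd i ρ (x - z) • F z := by
  have h := hρs.hasFDerivAt_convolution_right ((ContinuousLinearMap.lsmul ℝ ℝ).flip)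
    hF.locallyIntegrable (hρ.of_le (by simp)) x
  have h' := h.fderiv
  have : (fun x => ∫ z, ρ (x - z) • F z) =
      convolution F ρ ((ContinuousLinearMap.lsmul ℝ ℝ).flip : Vec d →L[ℝ] ℝ →L[ℝ] Vec d)
        volume := rfl
  rw [pd, this, h', convolution_precompR_apply]
  · rfl
  · exact hF.locallyIntegrable
  · exact hρs.fderiv (𝕜 := ℝ)
  · exact hρ.continuous_fderiv (by simp)

/-- The mollification at a scale smaller than the distance from the support of `F` to the boundary
of `Ω`. -/
theorem exists_mollified_test {F : Vec d → Vec d} {K : Set (Vec d)} (hK : IsCompact K)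
    (hFK : ∀ x, x ∉ K → F x = 0) (hF : Integrable F (volume : Measure (Vec d)))
    {δ : ℝ} (hKδ : Metric.cthickening δ K ⊆ Ω) {ρ : Vec d → ℝ}
    (hρ : ContDiff ℝ (⊤ : ℕ∞) ρ) (hρs : ∀ y, δ < ‖y‖ → ρ y = 0) :
    ∃ χ : 𝓓(Ω, Vec d), ∀ x, χ x = ∫ z, ρ (x - z) • F z := by
  have hρc : HasCompactSupport ρ :=
    HasCompactSupport.intro (isCompact_closedBall (0 : Vec d) δ) fun y hy => hρs y (by
      simpa using hy)
  have hz : ∀ x, x ∉ Metric.cthickening δ K → ∫ z, ρ (x - z) • F z = 0 := fun x hx => by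
    refine integral_eq_zero_of_ae (Eventually.of_forall fun z => ?_)
    by_cases hzK : z ∈ K
    · have : ρ (x - z) = 0 := hρs _ (by
        by_contra! hle
        exact hx (Metric.mem_cthickening_of_dist_le x z δ K hzK (by rwa [dist_eq_norm])))
      simp [this]
    · simp [hFK z hzK]
  have hcs : HasCompactSupport fun x => ∫ z, ρ (x - z) • F z :=
    HasCompactSupport.intro hK.cthickening hz
  refine ⟨⟨fun x => ∫ z, ρ (x - z) • F z, ?_, hcs, ?_⟩, fun x => rfl⟩
  · exact hρc.contDiff_convolution_right ((ContinuousLinearMap.lsmul ℝ ℝ).flip)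
      hF.locallyIntegrable hρ
  · refine subset_trans (closure_minimal (fun x hx => ?_) Metric.isClosed_cthickening) hKδ
    by_contra h
    exact hx (hz x h)

theorem memLp_of_restrict {V : Type} [NormedAddCommGroup V] {p : ℝ≥0∞} {f : Vec d → V}
    (hf : MemLp f p (vol Ω)) (h0 : ∀ x ∉ (Ω : Set (Vec d)), f x = 0) :
    MemLp f p (volume : Measure (Vec d)) := by
  have := (memLp_indicator_iff_restrict Ω.isOpen.measurableSet).2 hf
  rwa [Set.indicator_eq_self.2 fun x hx => by_contra fun hxΩ => hx (h0 x hxΩ)] at this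

theorem test_eq_zero {V : Type} [NormedAddCommGroup V] [NormedSpace ℝ V] (φ : 𝓓(Ω, V)) {x : Vec d}
    (hx : x ∉ (Ω : Set (Vec d))) : φ x = 0 :=
  image_eq_zero_of_notMem_tsupport fun h => hx (φ.tsupport_subset h)

theorem pd_test_eq_zero {V : Type} [NormedAddCommGroup V] [NormedSpace ℝ V] (φ : 𝓓(Ω, V))
    {x : Vec d} (hx : x ∉ tsupport φ) (i : Fin d) : pd i φ x = 0 := by
  rw [pd, image_eq_zero_of_notMem_tsupport fun h => hx (tsupport_fderiv_subset ℝ h)]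
  rfl

theorem exists_norm_test_le {V : Type} [NormedAddCommGroup V] [NormedSpace ℝ V] (φ : 𝓓(Ω, V)) :
    ∃ C, ∀ x, ‖φ x‖ ≤ C :=
  φ.continuous.bounded_above_of_compact_support φ.hasCompactSupport

theorem exists_norm_pd_test_le {V : Type} [NormedAddCommGroup V] [NormedSpace ℝ V] (φ : 𝓓(Ω, V))
    (i : Fin d) : ∃ C, ∀ x, ‖pd i φ x‖ ≤ C :=
  (continuous_pd i φ.contDiff).bounded_above_of_compact_support
    (hasCompactSupport_pd i φ.hasCompactSupport)

theorem memLp_continuous_smul {V : Type} [NormedAddCommGroup V] [NormedSpace ℝ V]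
    {μ : Measure (Vec d)} {p : ℝ≥0∞} {η : Vec d → ℝ} (hη : Continuous η) (hC : ∃ C, ∀ x, ‖η x‖ ≤ C)
    {f : Vec d → V} (hf : MemLp f p μ) : MemLp (fun x => η x • f x) p μ := by
  obtain ⟨C, hC⟩ := hC
  refine hf.of_le_mul (c := C) (hη.aestronglyMeasurable.smul hf.1)
    (Eventually.of_forall fun x => ?_)
  rw [norm_smul]
  gcongr
  exact hC x

/-- The mollification of `θ B` has as curl the mollification of `θ curl B + ∇θ × B`. -/
theorem SkewProduct.curl_mollified (S : SkewProduct d G) {B : Vec d → Vec d} {J : Vec d → G}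
    (hB : Integrable B (vol Ω)) (hJ : Integrable J (vol Ω)) (hBJ : S.HasWeakCocurl Ω B J)
    (θ : 𝓓(Ω, ℝ)) {ρ : Vec d → ℝ} (hρ : ContDiff ℝ (⊤ : ℕ∞) ρ) (hρs : HasCompactSupport ρ)
    (x : Vec d) :
    S.curl (fun x => ∫ z, ρ (x - z) • (θ z • B z)) x =
      ∫ z, ρ (x - z) • (θ z • J z + ∑ i, pd i θ z • S.cross (stdVec i) (B z)) := by
  set F : Vec d → Vec d := fun z => θ z • B z with hFdef
  set H : Vec d → G := fun z => θ z • J z + ∑ i, pd i θ z • S.cross (stdVec i) (B z) with hHdef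
  have hB' := memLp_one_iff_integrable.2 hB
  have hJ' := memLp_one_iff_integrable.2 hJ
  have hcr : ∀ i, MemLp (fun z => S.cross (stdVec i) (B z)) 1 (vol Ω) := fun i =>
    hB'.continuousLinearMap_comp (S.cross (stdVec i))
  have hθc : ∀ i, Continuous (pd i θ) := fun i => continuous_pd i θ.contDiff
  have hF : Integrable F volume := memLp_one_iff_integrable.1 (memLp_of_restrict
    (memLp_continuous_smul θ.continuous (exists_norm_test_le θ) hB')
    fun x hx => by simp [hFdef, test_eq_zero θ hx])
  have hH : Integrable H volume := by
    refine memLp_one_iff_integrable.1 (memLp_of_restrict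
      ((memLp_continuous_smul θ.continuous (exists_norm_test_le θ) hJ').add
        (memLp_finsetSum _ fun i _ =>
          memLp_continuous_smul (hθc i) (exists_norm_pd_test_le θ i) (hcr i))) fun x hx => ?_)
    have hx' : x ∉ tsupport θ := fun h => hx (θ.tsupport_subset h)
    change θ x • J x + ∑ i, pd i θ x • S.cross (stdVec i) (B x) = 0
    simp [test_eq_zero θ hx, pd_test_eq_zero θ hx']
  -- the translated and reflected mollifier
  set r : Vec d → ℝ := fun z => ρ (x - z) with hr
  have hrs : ContDiff ℝ (⊤ : ℕ∞) r := hρ.comp (contDiff_const.sub contDiff_id)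
  have hrd : ∀ i z, pd i r z = -pd i ρ (x - z) := fun i z => by
    have := pd_comp i (hρ.differentiable (by simp)) (φ := fun z : Vec d => x - z)
      ((differentiable_const x).sub differentiable_id) z
    have h2 : pd i (fun z : Vec d => x - z) z = -stdVec i := by
      rw [pd, fderiv_const_sub, fderiv_fun_id]
      simp
    rw [hr, this, h2, map_neg]
    rfl
  have hrc : ∀ i, Continuous fun z => pd i ρ (x - z) := fun i =>
    (continuous_pd i hρ).comp (continuous_const.sub continuous_id)
  obtain ⟨Cρ, hCρ⟩ := hρ.continuous.bounded_above_of_compact_support hρs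
  have hCr : ∃ C, ∀ z, ‖r z‖ ≤ C := ⟨Cρ, fun z => hCρ _⟩
  have hCd : ∀ i, ∃ C, ∀ z, ‖pd i ρ (x - z)‖ ≤ C := fun i => by
    obtain ⟨C, hC⟩ := (continuous_pd i hρ).bounded_above_of_compact_support
      (hasCompactSupport_pd i hρs)
    exact ⟨C, fun z => hC _⟩
  refine ext_inner_right ℝ fun e => ?_
  have hb : ∀ i, MemLp (fun z => inner ℝ (S.cross (stdVec i) (B z)) e) 1 (vol Ω) := fun i => by
    simpa [real_inner_comm] using (hcr i).continuousLinearMap_comp (innerSL ℝ e)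
  have hj : MemLp (fun z => inner ℝ (J z) e) 1 (vol Ω) := by
    simpa [real_inner_comm] using hJ'.continuousLinearMap_comp (innerSL ℝ e)
  have lhs : inner ℝ (S.curl (fun x => ∫ z, ρ (x - z) • F z) x) e =
      ∑ i, ∫ z, pd i ρ (x - z) * (θ z * inner ℝ (S.cross (stdVec i) (B z)) e) ∂(vol Ω) := by
    rw [SkewProduct.curl, sum_inner]
    refine Finset.sum_congr rfl fun i _ => ?_
    rw [pd_mollified hF hρ hρs]
    have hI : Integrable (fun z => pd i ρ (x - z) • F z) volume :=
      memLp_one_iff_integrable.1 (memLp_continuous_smul (hrc i) (hCd i)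
        (memLp_one_iff_integrable.2 hF))
    rw [real_inner_comm, ← ContinuousLinearMap.integral_comp_comm _ hI, ← integral_inner
      ((S.cross (stdVec i)).integrable_comp hI),
      ← setIntegral_eq_integral_of_forall_compl_eq_zero (s := (Ω : Set (Vec d)))]
    · simp [hFdef, inner_smul_right, real_inner_comm]
    · intro z hz
      simp [hFdef, test_eq_zero θ hz]
  have rhs : inner ℝ (∫ z, ρ (x - z) • H z) e =
      ∫ z, r z * (θ z * inner ℝ (J z) e) ∂(vol Ω) +
        ∑ i, ∫ z, r z * (pd i θ z * inner ℝ (S.cross (stdVec i) (B z)) e) ∂(vol Ω) := by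
    rw [← integral_finsetSum, ← integral_add, real_inner_comm, ← integral_inner,
      ← setIntegral_eq_integral_of_forall_compl_eq_zero (s := (Ω : Set (Vec d)))]
    · refine integral_congr_ae (Eventually.of_forall fun z => ?_)
      simp only [hHdef, inner_smul_right, inner_add_right, inner_sum, hr, real_inner_comm e,
        mul_add, Finset.mul_sum]
    · intro z hz
      have hz' : z ∉ tsupport θ := fun h => hz (θ.tsupport_subset h)
      simp [hHdef, test_eq_zero θ hz, pd_test_eq_zero θ hz']
    · exact memLp_one_iff_integrable.1 (memLp_continuous_smul hrs.continuous hCr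
        (memLp_one_iff_integrable.2 hH))
    · exact memLp_one_iff_integrable.1 (memLp_continuous_smul hrs.continuous hCr
        (memLp_continuous_smul θ.continuous (exists_norm_test_le θ) hj))
    · exact integrable_finsetSum _ fun i _ =>
        memLp_one_iff_integrable.1 (memLp_continuous_smul hrs.continuous hCr
        (memLp_continuous_smul (hθc i) (exists_norm_pd_test_le θ i) (hb i)))
    · exact fun i _ =>
        memLp_one_iff_integrable.1 (memLp_continuous_smul hrs.continuous hCr
        (memLp_continuous_smul (hθc i) (exists_norm_pd_test_le θ i) (hb i)))
  -- the weak curl of `B`, tested with `z ↦ ρ (x - z) θ z e`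
  let T : ℝ →L[ℝ] G := ContinuousLinearMap.toSpanSingleton ℝ e
  let ψ : 𝓓(Ω, G) := smulTest r hrs (compTest T T.contDiff (map_zero T) θ)
  have hψd : ∀ i z, pd i ψ z = (r z * pd i θ z - pd i ρ (x - z) * θ z) • e := fun i z => by
    have h1 := pd_smul i (hrs.differentiable (by simp))
      (differentiable_test (compTest T T.contDiff (map_zero T) θ)) z
    have h2 := pd_comp i T.differentiable (differentiable_test θ) z
    rw [ContinuousLinearMap.fderiv] at h2
    change pd i (fun z => r z • (compTest T T.contDiff (map_zero T) θ) z) z = _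
    rw [h1]
    change r z • pd i (fun z => T (θ z)) z + pd i r z • T (θ z) = _
    rw [h2, hrd]
    simp [T, sub_smul, smul_smul]
    abel
  have hw := hBJ ψ
  have e1 : ∫ z, inner ℝ (J z) (ψ z) ∂(vol Ω) =
      ∫ z, r z * (θ z * inner ℝ (J z) e) ∂(vol Ω) := by
    refine integral_congr_ae (Eventually.of_forall fun z => ?_)
    simp [ψ, T, inner_smul_right]
  have e2 : ∫ z, inner ℝ (B z) (S.cocurl ψ z) ∂(vol Ω) =
      ∑ i, ∫ z, pd i ρ (x - z) * (θ z * inner ℝ (S.cross (stdVec i) (B z)) e) ∂(vol Ω) -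
      ∑ i, ∫ z, r z * (pd i θ z * inner ℝ (S.cross (stdVec i) (B z)) e) ∂(vol Ω) := by
    have i1 : ∀ i, Integrable
        (fun z => pd i ρ (x - z) * (θ z * inner ℝ (S.cross (stdVec i) (B z)) e)) (vol Ω) := fun i =>
      memLp_one_iff_integrable.1 (memLp_continuous_smul (hrc i) (hCd i)
        (memLp_continuous_smul θ.continuous (exists_norm_test_le θ) (hb i)))
    have i2 : ∀ i, Integrable
        (fun z => r z * (pd i θ z * inner ℝ (S.cross (stdVec i) (B z)) e)) (vol Ω) := fun i =>
      memLp_one_iff_integrable.1 (memLp_continuous_smul hrs.continuous hCr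
        (memLp_continuous_smul (hθc i) (exists_norm_pd_test_le θ i) (hb i)))
    rw [← Finset.sum_sub_distrib]
    simp_rw [← integral_sub (i1 _) (i2 _)]
    rw [← integral_finsetSum]
    swap
    · exact fun i _ => (i1 i).sub (i2 i)
    refine integral_congr_ae (Eventually.of_forall fun z => ?_)
    simp only [SkewProduct.cocurl, inner_neg_right, inner_sum, hψd, map_smul,
      smul_apply, inner_smul_right, S.inner_act, ← Finset.sum_neg_distrib]
    exact Finset.sum_congr rfl fun i _ => by ring
  rw [lhs, rhs, ← e1, hw, e2]
  ring

/-- If `J = curl B` and `M = curl E` weakly, then `∫ θ M · B = ∫ E · curl (θ B)` for every scalar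
test function `θ`: the field `θ B` may be mollified inside `Ω`. -/
theorem SkewProduct.integral_curl_mul_test [IsFiniteMeasure (vol Ω)] (S : SkewProduct d G)
    {B M : Vec d → Vec d} {J E : Vec d → G} (hB : MemLp B 2 (vol Ω)) (hM : MemLp M 2 (vol Ω))
    (hJ : MemLp J 2 (vol Ω)) (hE : MemLp E 2 (vol Ω))
    (hBJ : S.HasWeakCocurl Ω B J) (hEM : S.HasWeakCurl Ω E M) (θ : 𝓓(Ω, ℝ)) :
    ∫ x, θ x * inner ℝ (M x) (B x) ∂(vol Ω) =
      ∫ x, θ x * inner ℝ (E x) (J x) ∂(vol Ω) +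
        ∑ i, ∫ x, pd i θ x * inner ℝ (E x) (S.cross (stdVec i) (B x)) ∂(vol Ω) := by
  set F : Vec d → Vec d := fun z => θ z • B z with hFdef
  set H : Vec d → G := fun z => θ z • J z + ∑ i, pd i θ z • S.cross (stdVec i) (B z) with hHdef
  have hcr : ∀ i, MemLp (fun z => S.cross (stdVec i) (B z)) 2 (vol Ω) := fun i =>
    hB.continuousLinearMap_comp (S.cross (stdVec i))
  have hθc : ∀ i, Continuous (pd i θ) := fun i => continuous_pd i θ.contDiff
  have hFΩ := memLp_continuous_smul θ.continuous (exists_norm_test_le θ) hB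
  have hHΩ := (memLp_continuous_smul θ.continuous (exists_norm_test_le θ) hJ).add
    (memLp_finsetSum Finset.univ fun i _ =>
      memLp_continuous_smul (hθc i) (exists_norm_pd_test_le θ i) (hcr i))
  have hF0 : ∀ x ∉ (Ω : Set (Vec d)), F x = 0 := fun x hx => by simp [hFdef, test_eq_zero θ hx]
  have hH0 : ∀ x ∉ (Ω : Set (Vec d)), H x = 0 := fun x hx => by
    have hx' : x ∉ tsupport θ := fun h => hx (θ.tsupport_subset h)
    simp [hHdef, test_eq_zero θ hx, pd_test_eq_zero θ hx']
  have hFV : MemLp F 2 volume := memLp_of_restrict hFΩ hF0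
  have hHV : MemLp H 2 volume := memLp_of_restrict hHΩ hH0
  have hF1 : Integrable F volume := memLp_one_iff_integrable.1
    (memLp_of_restrict (hFΩ.mono_exponent one_le_two) hF0)
  have hH1 : Integrable H volume := memLp_one_iff_integrable.1
    (memLp_of_restrict (hHΩ.mono_exponent one_le_two) hH0)
  have hB1 := hB.integrable one_le_two
  have hJ1 := hJ.integrable one_le_two
  have hM1 := hM.integrable one_le_two
  have hE1 := hE.integrable one_le_two
  obtain ⟨δ, hδ, hKδ⟩ :=
    θ.hasCompactSupport.isCompact.exists_cthickening_subset_open Ω.isOpen θ.tsupport_subset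
  -- the two correlations have the same averages against all mollifiers of small support
  have avg : ∀ ρ : Vec d → ℝ, ContDiff ℝ (⊤ : ℕ∞) ρ → (∀ y, δ < ‖y‖ → ρ y = 0) →
      ∫ y, ρ y * ∫ x, inner ℝ (M x) (F (x + (0 - y))) ∂(vol Ω) =
        ∫ y, ρ y * ∫ x, inner ℝ (E x) (H (x + (0 - y))) ∂(vol Ω) := fun ρ hρ hρ0 => by
    have hρs : HasCompactSupport ρ :=
      HasCompactSupport.intro (isCompact_closedBall (0 : Vec d) δ) fun y hy => hρ0 y (by
        simpa using hy)
    obtain ⟨χ, hχ⟩ := exists_mollified_test (F := F) θ.hasCompactSupport.isCompact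
      (fun x hx => by simp [hFdef, image_eq_zero_of_notMem_tsupport hx]) hF1 hKδ hρ hρ0
    have h1 := hEM χ
    have h2 : ∀ x, S.curl χ x = ∫ z, ρ (x - z) • H z := fun x => by
      rw [show (χ : Vec d → Vec d) = fun x => ∫ z, ρ (x - z) • F z from funext hχ]
      exact S.curl_mollified hB1 hJ1 hBJ θ hρ hρs x
    simp only [hχ, h2] at h1
    rwa [integral_inner_mollified hM1 hF1 hρ.continuous hρs,
      integral_inner_mollified hE1 hH1 hρ.continuous hρs] at h1
  have cF := continuous_correlation hM hFV
  have cH := continuous_correlation hE hHV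
  let b : ℕ → ContDiffBump (0 : Vec d) := fun n =>
    ⟨δ / (n + 1) / 2, δ / (n + 1), by positivity, half_lt_self (by positivity)⟩
  have hb : Tendsto (fun n => (b n).rOut) atTop (𝓝 0) :=
    tendsto_const_div_atTop_nhds_zero_nat δ |>.comp (tendsto_add_atTop_nat 1) |>.congr
      fun n => by simp [b]
  have limF := ContDiffBump.convolution_tendsto_right_of_continuous (μ := volume) hb cF 0
  have limH := ContDiffBump.convolution_tendsto_right_of_continuous (μ := volume) hb cH 0
  have same : ∀ n,
      (convolution ((b n).normed volume) (fun y => ∫ x, inner ℝ (M x) (F (x + y)) ∂(vol Ω))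
        (ContinuousLinearMap.lsmul ℝ ℝ) volume) (0 : Vec d) =
      (convolution ((b n).normed volume) (fun y => ∫ x, inner ℝ (E x) (H (x + y)) ∂(vol Ω))
        (ContinuousLinearMap.lsmul ℝ ℝ) volume) 0 := fun n => by
    refine avg _ (b n).contDiff_normed fun y hy => ?_
    have : y ∉ Function.support ((b n).normed volume) := by
      rw [ContDiffBump.support_normed_eq, mem_ball_zero_iff, not_lt]
      refine le_trans ?_ hy.le
      exact div_le_self hδ.le (by simp)
    simpa using this
  simp only [same] at limF
  have fin := tendsto_nhds_unique limF limH
  simp only [add_zero, hFdef, hHdef, inner_smul_right, inner_add_right, inner_sum] at fin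
  rw [fin, integral_add, integral_finsetSum]
  · exact fun i _ => memLp_one_iff_integrable.1 (memLp_continuous_smul (hθc i)
      (exists_norm_pd_test_le θ i) (memLp_inner_of_holder hE (hcr i)))
  · exact memLp_one_iff_integrable.1 (memLp_continuous_smul θ.continuous
      (exists_norm_test_le θ) (memLp_inner_of_holder hE hJ))
  · exact integrable_finsetSum _ fun i _ => memLp_one_iff_integrable.1
      (memLp_continuous_smul (hθc i) (exists_norm_pd_test_le θ i) (memLp_inner_of_holder hE (hcr i)))

end Green

/-! ### The induction equation tested with the magnetic field -/

section Induction

variable {d : ℕ} {Ω : Opens (Vec d)} {G : Type} [NormedAddCommGroup G] [InnerProductSpace ℝ G]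

/-- Smooth functions `h k` which vanish near the origin and converge to the indicator of its
complement, and for which `|y| |Dh k y|` is bounded uniformly in `k`. -/
theorem exists_cutoff (d : ℕ) : ∃ (h : ℕ → Vec d → ℝ) (C : ℝ),
    (∀ k, ContDiff ℝ (⊤ : ℕ∞) (h k)) ∧ (∀ k, h k 0 = 0) ∧ (∀ k y, ‖h k y‖ ≤ 1) ∧
    (∀ k, ∃ C', ∀ y, ‖fderiv ℝ (h k) y‖ ≤ C') ∧ (∀ k y, ‖y‖ * ‖fderiv ℝ (h k) y‖ ≤ C) ∧
    ∀ y, y ≠ 0 → ∀ᶠ k in atTop, h k y = 1 ∧ fderiv ℝ (h k) y = 0 := by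
  let b : ContDiffBump (0 : Vec d) := ⟨1, 2, one_pos, one_lt_two⟩
  obtain ⟨C, hC⟩ := exists_norm_fderiv_le (h := b) b.contDiff b.hasCompactSupport
  have hC0 : 0 ≤ C := (norm_nonneg _).trans (hC 0)
  have hb : Differentiable ℝ b := (b.contDiff (n := 1)).differentiable (by simp)
  have hd : ∀ (k : ℕ) (y : Vec d), fderiv ℝ (fun y => 1 - b ((k : ℝ) • y)) y =
      -((k : ℝ) • fderiv ℝ b ((k : ℝ) • y)) := fun k y => by
    rw [fderiv_const_sub, fderiv_comp_smul]
  -- `b` is locally constant off the shell `1 ≤ |y| ≤ 2`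
  have hfar : ∀ y : Vec d, 2 < ‖y‖ → b y = 0 ∧ fderiv ℝ b y = 0 := fun y hy => by
    have hev : (b : Vec d → ℝ) =ᶠ[𝓝 y] fun _ => 0 := by
      filter_upwards [(isOpen_lt continuous_const continuous_norm).mem_nhds hy] with z hz
      exact b.zero_of_le_dist (by rw [dist_zero_right]; exact le_of_lt hz)
    exact ⟨hev.self_of_nhds, by rw [hev.fderiv_eq]; simp⟩
  refine ⟨fun k y => 1 - b ((k : ℝ) • y), 2 * C, fun k => ?_, fun k => ?_, fun k y => ?_,
    fun k => ⟨k * C, fun y => ?_⟩, fun k y => ?_, fun y hy => ?_⟩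
  · exact contDiff_const.sub (b.contDiff.comp (contDiff_const_smul _))
  · have : b (0 : Vec d) = 1 := b.one_of_mem_closedBall (by simp [b])
    simp [this]
  · have h0 : 0 ≤ b ((k : ℝ) • y) := b.nonneg
    have h1 : b ((k : ℝ) • y) ≤ 1 := b.le_one
    rw [Real.norm_eq_abs, abs_le]
    constructor <;> linarith
  · rw [hd, norm_neg, norm_smul, Real.norm_natCast]
    gcongr
    exact hC _
  · rw [hd, norm_neg, norm_smul, Real.norm_natCast]
    rcases le_or_gt ‖(k : ℝ) • y‖ 2 with hle | hlt
    · rw [norm_smul, Real.norm_natCast] at hle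
      calc ‖y‖ * (k * ‖fderiv ℝ b ((k : ℝ) • y)‖) = (k * ‖y‖) * ‖fderiv ℝ b ((k : ℝ) • y)‖ := by ring
        _ ≤ 2 * C := by gcongr; exact hC _
    · rw [(hfar _ hlt).2]
      simpa using hC0
  · have hlim : Tendsto (fun k : ℕ => (k : ℝ) * ‖y‖) atTop atTop :=
      tendsto_natCast_atTop_atTop.atTop_mul_const (norm_pos_iff.2 hy)
    filter_upwards [hlim.eventually_gt_atTop 2] with k hk
    have hk' : 2 < ‖(k : ℝ) • y‖ := by rwa [norm_smul, Real.norm_natCast]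
    rw [hd, (hfar _ hk').1, (hfar _ hk').2]
    simp

variable (S : SkewProduct d G) {u B M : L2 Ω (Vec d)} {Du : Fin d → L2 Ω (Vec d)} {J : L2 Ω G}

theorem SkewProduct.norm_cross_le (v w : Vec d) : ‖S.cross v w‖ ≤ ‖S.cross‖ * ‖v‖ * ‖w‖ :=
  S.cross.le_opNorm₂ v w

theorem SkewProduct.memLp_cross {u B : Vec d → Vec d} {p : ℝ≥0∞} (hu : MemLp u ⊤ (vol Ω))
    (hB : MemLp B p (vol Ω)) : MemLp (fun x => S.cross (u x) (B x)) p (vol Ω) := by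
  obtain ⟨R, hR⟩ := exists_ae_norm_le hu
  refine hB.of_le_mul (c := ‖S.cross‖ * R) (S.cross.aestronglyMeasurable_comp₂ hu.1 hB.1) ?_
  filter_upwards [hR] with x hx
  refine (S.norm_cross_le _ _).trans ?_
  gcongr

/-- The density `(u × B) · (eᵢ × B)`. -/
noncomputable def SkewProduct.stress (S : SkewProduct d G) (u B : Vec d → Vec d) (i : Fin d)
    (x : Vec d) : ℝ :=
  inner ℝ (S.cross (u x) (B x)) (S.cross (stdVec i) (B x))

theorem SkewProduct.memLp_stress {u B : Vec d → Vec d} (hu : MemLp u ⊤ (vol Ω))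
    (hB : MemLp B 3 (vol Ω)) (i : Fin d) : MemLp (S.stress u B i) (3 / 2) (vol Ω) :=
  memLp_inner_of_holder (S.memLp_cross hu hB) (hB.continuousLinearMap_comp (S.cross (stdVec i)))

theorem SkewProduct.norm_stress_le (u B : Vec d → Vec d) (i : Fin d) (x : Vec d) :
    ‖S.stress u B i x‖ ≤ ‖S.cross‖ ^ 2 * ‖u x‖ * inner ℝ (B x) (B x) := by
  have h := S.norm_cross_le (stdVec i) (B x)
  rw [PiLp.norm_single, norm_one, mul_one] at h
  calc ‖S.stress u B i x‖ ≤ ‖S.cross (u x) (B x)‖ * ‖S.cross (stdVec i) (B x)‖ :=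
        norm_inner_le_norm _ _
    _ ≤ (‖S.cross‖ * ‖u x‖ * ‖B x‖) * (‖S.cross‖ * ‖B x‖) := by
        gcongr
        exact S.norm_cross_le _ _
    _ = ‖S.cross‖ ^ 2 * ‖u x‖ * inner ℝ (B x) (B x) := by
        rw [real_inner_self_eq_norm_sq]; ring

variable [FiniteDimensional ℝ G] [IsFiniteMeasure (vol Ω)]

/-- Integration by parts for `M = curl (u × B)` and `J = curl B` against the weight `θ h(u)`, which
is a limit of test functions since `h` vanishes at the origin and `u` on the boundary. -/
theorem SkewProduct.integral_curl_mul_comp (hu : ZeroOnBoundary u Du) (hb : MemLp u ⊤ (vol Ω))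
    (hB : MemLp B 3 (vol Ω)) (hBJ : S.HasWeakCocurl Ω B J)
    (hM : S.HasWeakCurl Ω (fun x => S.cross (u x) (B x)) M)
    {θ : Vec d → ℝ} (hθ : ContDiff ℝ (⊤ : ℕ∞) θ) (hθb : ∃ C, ∀ x, ‖θ x‖ ≤ C)
    (hθd : ∀ i, ∃ C, ∀ x, ‖pd i θ x‖ ≤ C) {h : Vec d → ℝ} (hh : ContDiff ℝ (⊤ : ℕ∞) h)
    (h0 : h 0 = 0) {C : ℝ} (hC : ∀ y, ‖h y‖ ≤ C) {C' : ℝ} (hC' : ∀ y, ‖fderiv ℝ h y‖ ≤ C') :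
    ∫ x, (θ x * inner ℝ (M x) (B x)) * h (u x) ∂(vol Ω) =
      ∫ x, (θ x * inner ℝ (S.cross (u x) (B x)) (J x)) * h (u x) ∂(vol Ω) +
        ∑ i, (∫ x, (θ x * S.stress u B i x) * fderiv ℝ h (u x) (Du i x) ∂(vol Ω) +
          ∫ x, (pd i θ x * S.stress u B i x) * h (u x) ∂(vol Ω)) := by
  obtain ⟨φ, hφ⟩ := hu.exists_approximates
  have hA := hφ.comp hb.1 hh h0 hC'
  have hE := S.memLp_cross hb (Lp.memLp B)
  have hpair : ∀ {g : Vec d → ℝ}, Integrable g (vol Ω) →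
      Tendsto (fun n => ∫ x, g x * h (φ n x) ∂(vol Ω)) atTop
        (𝓝 (∫ x, g x * h (u x) ∂(vol Ω))) := fun {g} hg => by
    have := tendsto_integral_inner_of_bounded hg
      (f := fun n => compTest h hh h0 (φ n))
      (fun n => (TestFunction.continuous _).aestronglyMeasurable)
      (fun n x => hC (φ n x)) hA.ae_tendsto
    simpa [mul_comm] using this
  have hm : Integrable (fun x => θ x * inner ℝ (M x) (B x)) (vol Ω) :=
    memLp_one_iff_integrable.1 (memLp_continuous_smul hθ.continuous hθb
      (memLp_inner_of_holder (Lp.memLp M) (Lp.memLp B)))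
  have he : Integrable (fun x => θ x * inner ℝ (S.cross (u x) (B x)) (J x)) (vol Ω) :=
    memLp_one_iff_integrable.1 (memLp_continuous_smul hθ.continuous hθb
      (memLp_inner_of_holder hE (Lp.memLp J)))
  have hs : ∀ i, MemLp (fun x => θ x * S.stress u B i x) (3 / 2) (vol Ω) := fun i =>
    memLp_continuous_smul hθ.continuous hθb (S.memLp_stress hb hB i)
  have hs' : ∀ i, Integrable (fun x => pd i θ x * S.stress u B i x) (vol Ω) := fun i =>
    (memLp_continuous_smul (continuous_pd i hθ) (hθd i) (S.memLp_stress hb hB i)).integrable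
      one_le_three_div_two
  have hgrad : ∀ i, Tendsto
      (fun n => ∫ x, (θ x * S.stress u B i x) * pd i (compTest h hh h0 (φ n)) x ∂(vol Ω)) atTop
      (𝓝 (∫ x, (θ x * S.stress u B i x) * fderiv ℝ h (u x) (Du i x) ∂(vol Ω))) := fun i => by
    have := tendsto_integral_inner (p := 3 / 2) (q := 3) (hs i)
      (fun n => memLp_pd_test i (compTest h hh h0 (φ n)) 3) (hA.memLp_deriv i) (hA.tendsto_pd i)
    simpa [mul_comm] using this
  have hlim := (hpair he).add (tendsto_finsetSum Finset.univ
    fun i _ => (hgrad i).add (hpair (hs' i)))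
  refine tendsto_nhds_unique ((hpair hm).congr fun n => ?_) hlim
  have key := S.integral_curl_mul_test (Lp.memLp B) (Lp.memLp M) (Lp.memLp J) hE hBJ hM
    (smulTest θ hθ (compTest h hh h0 (φ n)))
  have hpd : ∀ i x, pd i (smulTest θ hθ (compTest h hh h0 (φ n))) x =
      θ x * pd i (compTest h hh h0 (φ n)) x + pd i θ x * h (φ n x) := fun i x =>
    pd_smul i (hθ.differentiable (by simp)) (differentiable_test (compTest h hh h0 (φ n))) x
  simp only [smulTest_apply, compTest_apply, hpd, smul_eq_mul] at key
  calc ∫ x, (θ x * inner ℝ (M x) (B x)) * h (φ n x) ∂(vol Ω)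
      = ∫ x, θ x * h (φ n x) * inner ℝ (M x) (B x) ∂(vol Ω) := by
        congr 1 with x; ring
    _ = _ := key
    _ = _ := by
        congr 1
        · congr 1 with x; ring
        · refine Finset.sum_congr rfl fun i _ => ?_
          rw [← integral_add]
          · congr 1 with x
            simp only [SkewProduct.stress]
            ring
          · exact memLp_one_iff_integrable.1 (by
              simpa using memLp_inner_of_holder (p := 3) (q := 3 / 2) (r := 1)
                (memLp_pd_test i (compTest h hh h0 (φ n)) 3) (hs i))
          · obtain ⟨c, hc⟩ := exists_norm_test_le (compTest h hh h0 (φ n))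
            exact (hs' i).mul_bdd (c := c)
              (TestFunction.continuous (compTest h hh h0 (φ n))).aestronglyMeasurable
              (Eventually.of_forall hc)

/-- The limit of `SkewProduct.integral_curl_mul_comp` along cutoffs `h` that tend to the indicator of
`u ≠ 0`. Since `|u| |Dh(u)|` stays bounded, the terms with `Dh(u)` disappear in the limit. -/
theorem SkewProduct.integral_curl_mul_ne_zero (hu : ZeroOnBoundary u Du) (hb : MemLp u ⊤ (vol Ω))
    (hB : MemLp B 3 (vol Ω)) (hBJ : S.HasWeakCocurl Ω B J)
    (hM : S.HasWeakCurl Ω (fun x => S.cross (u x) (B x)) M)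
    {θ : Vec d → ℝ} (hθ : ContDiff ℝ (⊤ : ℕ∞) θ) (hθb : ∃ C, ∀ x, ‖θ x‖ ≤ C)
    (hθd : ∀ i, ∃ C, ∀ x, ‖pd i θ x‖ ≤ C) :
    ∫ x, (θ x * inner ℝ (M x) (B x)) * (if u x = 0 then 0 else 1) ∂(vol Ω) =
      ∫ x, θ x * inner ℝ (S.cross (u x) (B x)) (J x) ∂(vol Ω) +
        ∑ i, ∫ x, pd i θ x * S.stress u B i x ∂(vol Ω) := by
  obtain ⟨h, C, hh, h0, hle, hbd, hC, hev⟩ := exists_cutoff d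
  have hE := S.memLp_cross hb (Lp.memLp B)
  have hm : Integrable (fun x => θ x * inner ℝ (M x) (B x)) (vol Ω) :=
    memLp_one_iff_integrable.1 (memLp_continuous_smul hθ.continuous hθb
      (memLp_inner_of_holder (Lp.memLp M) (Lp.memLp B)))
  have he : Integrable (fun x => θ x * inner ℝ (S.cross (u x) (B x)) (J x)) (vol Ω) :=
    memLp_one_iff_integrable.1 (memLp_continuous_smul hθ.continuous hθb
      (memLp_inner_of_holder hE (Lp.memLp J)))
  have hs' : ∀ i, Integrable (fun x => pd i θ x * S.stress u B i x) (vol Ω) := fun i =>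
    (memLp_continuous_smul (continuous_pd i hθ) (hθd i) (S.memLp_stress hb hB i)).integrable
      one_le_three_div_two
  have hpt : ∀ x, Tendsto (fun k => h k (u x)) atTop (𝓝 (if u x = 0 then 0 else 1)) := fun x => by
    by_cases hx : u x = 0
    · simp [hx, h0]
    · rw [if_neg hx]
      exact tendsto_const_nhds.congr' ((hev _ hx).mono fun k hk => hk.1.symm)
  have hpair : ∀ {g : Vec d → ℝ}, Integrable g (vol Ω) →
      Tendsto (fun k => ∫ x, g x * h k (u x) ∂(vol Ω)) atTop
        (𝓝 (∫ x, g x * (if u x = 0 then 0 else 1) ∂(vol Ω))) := fun {g} hg => by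
    have := tendsto_integral_inner_of_bounded hg (f := fun k x => h k (u x))
      (fun k => (hh k).continuous.comp_aestronglyMeasurable hb.1)
      (fun k x => hle k (u x)) (Eventually.of_forall hpt)
    simpa [mul_comm] using this
  obtain ⟨Cθ, hCθ⟩ := hθb
  have hdom : ∀ i, Integrable (fun x => inner ℝ (B x) (B x) * ‖Du i x‖) (vol Ω) := fun i => by
    have h1 : MemLp (fun x => inner ℝ (B x) (B x)) (3 / 2) (vol Ω) := memLp_inner_of_holder hB hB
    exact memLp_one_iff_integrable.1 (by
      simpa [mul_comm] using
        memLp_inner_of_holder (p := 3 / 2) (q := 3) (r := 1) h1 (hu.2.1 i).norm)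
  have hgrad : ∀ i, Tendsto
      (fun k => ∫ x, (θ x * S.stress u B i x) * fderiv ℝ (h k) (u x) (Du i x) ∂(vol Ω)) atTop
      (𝓝 0) := fun i => by
    rw [← integral_zero (Vec d) ℝ (μ := vol Ω)]
    -- the majorant is a product of three functions in `L³`
    refine tendsto_integral_of_dominated_convergence
      (fun x => Cθ * ‖S.cross‖ ^ 2 * C * (inner ℝ (B x) (B x) * ‖Du i x‖)) (fun k => ?_)
      ((hdom i).const_mul _) (fun k => Eventually.of_forall fun x => ?_)
      (Eventually.of_forall fun x => ?_)
    · refine (hθ.continuous.aestronglyMeasurable.mul (S.memLp_stress hb hB i).1).mul ?_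
      exact (ContinuousLinearMap.apply ℝ ℝ).flip.aestronglyMeasurable_comp₂
        (((hh k).continuous_fderiv (by simp)).comp_aestronglyMeasurable hb.1) (hu.2.1 i).1
    · have hBB : 0 ≤ inner ℝ (B x) (B x) := real_inner_self_nonneg
      have hθ0 : 0 ≤ Cθ := (norm_nonneg _).trans (hCθ x)
      calc ‖(θ x * S.stress u B i x) * fderiv ℝ (h k) (u x) (Du i x)‖
          = ‖θ x‖ * ‖S.stress u B i x‖ * ‖fderiv ℝ (h k) (u x) (Du i x)‖ := by
            rw [norm_mul, norm_mul]
        _ ≤ Cθ * (‖S.cross‖ ^ 2 * ‖u x‖ * inner ℝ (B x) (B x)) *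
              (‖fderiv ℝ (h k) (u x)‖ * ‖Du i x‖) := by
            gcongr
            · exact hCθ x
            · exact S.norm_stress_le u B i x
            · exact (fderiv ℝ (h k) (u x)).le_opNorm _
        _ = Cθ * ‖S.cross‖ ^ 2 * (‖u x‖ * ‖fderiv ℝ (h k) (u x)‖) *
              (inner ℝ (B x) (B x) * ‖Du i x‖) := by ring
        _ ≤ _ := by gcongr; exact hC k _
    · by_cases hx : u x = 0
      · simp [SkewProduct.stress, hx]
      · refine tendsto_const_nhds.congr' ((hev _ hx).mono fun k hk => ?_)
        simp [hk.2]
  have hlim := (hpair he).add (tendsto_finsetSum Finset.univ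
    fun i _ => (hgrad i).add (hpair (hs' i)))
  have heq : ∀ k, _ := fun k => S.integral_curl_mul_comp hu hb hB hBJ hM hθ ⟨Cθ, hCθ⟩ hθd (hh k)
    (h0 k) (hle k) (hbd k).choose_spec
  rw [tendsto_nhds_unique ((hpair hm).congr heq) hlim]
  -- the remaining integrands vanish where `u = 0`
  congr 1
  · congr 1 with x
    by_cases hx : u x = 0 <;> simp [hx]
  · refine Finset.sum_congr rfl fun i _ => ?_
    rw [zero_add]
    congr 1 with x
    by_cases hx : u x = 0 <;> simp [hx, SkewProduct.stress]

/-- If `M = curl (u × B)` with `u = 0` on `∂Ω`, then `∫ M · B = ∫ (u × B) · curl B`, without any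
boundary condition on `B`. -/
theorem SkewProduct.integral_curl_mul (hu : ZeroOnBoundary u Du) (hb : MemLp u ⊤ (vol Ω))
    (hB : MemLp B 3 (vol Ω)) (hBJ : S.HasWeakCocurl Ω B J)
    (hM : S.HasWeakCurl Ω (fun x => S.cross (u x) (B x)) M) :
    ∫ x, inner ℝ (M x) (B x) ∂(vol Ω) = ∫ x, inner ℝ (S.cross (u x) (B x)) (J x) ∂(vol Ω) := by
  have hm : Integrable (fun x => inner ℝ (M x) (B x)) (vol Ω) :=
    memLp_one_iff_integrable.1 (memLp_inner_of_holder (Lp.memLp M) (Lp.memLp B))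
  have hι : AEStronglyMeasurable (fun x => if u x = 0 then (0 : ℝ) else 1) (vol Ω) :=
    (Measurable.ite (measurableSet_eq_fun (Lp.stronglyMeasurable u).measurable measurable_const)
      measurable_const measurable_const).aestronglyMeasurable
  have hmι : Integrable (fun x => inner ℝ (M x) (B x) * (if u x = 0 then 0 else 1)) (vol Ω) :=
    hm.mul_bdd (c := 1) hι (Eventually.of_forall fun x => by split_ifs <;> simp)
  -- the curl of `u × B` is orthogonal to `B` at almost every zero of `u`
  have hzero : (fun x => inner ℝ (M x) (B x) - inner ℝ (M x) (B x) * (if u x = 0 then 0 else 1))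
      =ᵐ[vol Ω] 0 := by
    refine ae_eq_zero_of_forall_test (hm.sub hmι) fun ψ => ?_
    have h1 := S.integral_curl_mul_test (Lp.memLp B) (Lp.memLp M) (Lp.memLp J)
      (S.memLp_cross hb (Lp.memLp B)) hBJ hM ψ
    have h2 := S.integral_curl_mul_ne_zero hu hb hB hBJ hM ψ.contDiff (exists_norm_test_le ψ)
      (exists_norm_pd_test_le ψ)
    obtain ⟨c, hc⟩ := exists_norm_test_le ψ
    simp_rw [mul_sub]
    rw [integral_sub, h1]
    · simp_rw [← mul_assoc]
      rw [h2]
      exact sub_self _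
    · exact hm.bdd_mul (c := c) ψ.continuous.aestronglyMeasurable (Eventually.of_forall hc)
    · exact hmι.bdd_mul (c := c) ψ.continuous.aestronglyMeasurable (Eventually.of_forall hc)
  have h := S.integral_curl_mul_ne_zero hu hb hB hBJ hM (θ := fun _ => 1) contDiff_const
    ⟨1, by simp⟩ (fun i => ⟨0, by simp [pd]⟩)
  have hp : ∀ (i : Fin d) (x : Vec d), pd i (fun _ : Vec d => (1 : ℝ)) x = 0 := by simp [pd]
  simp only [hp, one_mul, zero_mul, integral_zero, Finset.sum_const_zero, add_zero] at h
  rw [← h]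
  refine integral_congr_ae ?_
  filter_upwards [hzero] with x hx
  exact sub_eq_zero.1 hx

end Induction

/-! ### The energy balance at a fixed time -/

section MagneticBalance

variable {d : ℕ} {Ω : Opens (Vec d)} {G : Type} [NormedAddCommGroup G] [InnerProductSpace ℝ G]
  [FiniteDimensional ℝ G] [IsFiniteMeasure (vol Ω)] (S : SkewProduct d G)
  {u B : L2 Ω (Vec d)} {Du : Fin d → L2 Ω (Vec d)} {J : L2 Ω G}

omit [IsFiniteMeasure (vol Ω)] [FiniteDimensional ℝ G] in
theorem SkewProduct.memLp_cocurl_test (ψ : 𝓓(Ω, G)) (p : ℝ≥0∞) :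
    MemLp (S.cocurl ψ) p (vol Ω) :=
  (memLp_finsetSum Finset.univ fun i _ =>
    (memLp_pd_test i ψ p).continuousLinearMap_comp (S.act.flip (stdVec i))).neg

omit [IsFiniteMeasure (vol Ω)] [FiniteDimensional ℝ G] in
/-- If `J = curl B` is a limit of test functions in the norm of `L²` and of the curl, then
`∫ |J|² = ∫ B · curl J`. -/
theorem SkewProduct.norm_sq_weak_curl {K : L2 Ω (Vec d)} (hBJ : S.HasWeakCocurl Ω B J)
    {ψ : ℕ → 𝓓(Ω, G)} (hψ : TestTendsto (Ω := Ω) 2 (fun n => ψ n) J)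
    (hψK : TestTendsto (Ω := Ω) 2 (fun n => S.cocurl (ψ n)) K) : ‖J‖ ^ 2 = inner ℝ K B := by
  have h1 := tendsto_integral_inner (p := 2) (q := 2) (Lp.memLp J) (fun n => memLp_test (ψ n) 2)
    (Lp.memLp J) hψ
  have h2 := tendsto_integral_inner (p := 2) (q := 2) (Lp.memLp B)
    (fun n => S.memLp_cocurl_test (ψ n) 2) (Lp.memLp K) hψK
  have h3 := tendsto_nhds_unique (h1.congr fun n => hBJ (ψ n)) h2
  rw [← L2.inner_def, ← L2.inner_def] at h3
  rw [← real_inner_self_eq_norm_sq, h3, real_inner_comm]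

omit [IsFiniteMeasure (vol Ω)] in
theorem integral_inner_test {V : Type} [NormedAddCommGroup V] [InnerProductSpace ℝ V]
    (w : L2 Ω V) (φ : 𝓓(Ω, V)) :
    ∫ x, inner ℝ (w x) (φ x) ∂(vol Ω) = inner ℝ w ((memLp_test φ 2).toLp φ) := by
  rw [L2.inner_def]
  refine integral_congr_ae ?_
  filter_upwards [(memLp_test φ 2).coeFn_toLp] with x hx
  rw [hx]

/-- In the weak induction equation, the magnetic field itself may be used as a test function. Here
`b` is the time derivative of `B`. -/
theorem SkewProduct.magnetic_balance (hu : ZeroOnBoundary u Du) (hb : MemLp u ⊤ (vol Ω))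
    (hB : MemLp B 3 (vol Ω)) (hBJ : S.HasWeakCocurl Ω B J)
    {K : L2 Ω (Vec d)} (hJK : S.HasWeakCurl Ω J K)
    {ψ : ℕ → 𝓓(Ω, G)} (hψ : TestTendsto (Ω := Ω) 2 (fun n => ψ n) J)
    (hψK : TestTendsto (Ω := Ω) 2 (fun n => S.cocurl (ψ n)) K)
    {b : L2 Ω (Vec d)} {η s : ℝ} (hs : s ≠ 0)
    (heq : ∀ φ : 𝓓(Ω, Vec d),
      ∫ x, inner ℝ (b x) (φ x) ∂(vol Ω) + η * ∫ x, inner ℝ (J x) (S.curl φ x) ∂(vol Ω)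
        - s * ∫ x, inner ℝ (S.cross (u x) (B x)) (S.curl φ x) ∂(vol Ω) = 0) :
    inner ℝ b B + η * ‖J‖ ^ 2 - s * ∫ x, inner ℝ (S.cross (u x) (B x)) (J x) ∂(vol Ω) = 0 := by
  -- the induction equation exhibits the weak curl of `u × B` as an `L²` field
  have hM : S.HasWeakCurl Ω (fun x => S.cross (u x) (B x)) (s⁻¹ • (b + η • K) : L2 Ω (Vec d)) := by
    intro φ
    have h := heq φ
    rw [← hJK φ, integral_inner_test, integral_inner_test] at h
    rw [integral_inner_test, inner_smul_left, inner_add_left, inner_smul_left]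
    simp only [conj_trivial]
    field_simp
    linarith
  have h := S.integral_curl_mul hu hb hB hBJ hM
  rw [← L2.inner_def, inner_smul_left, inner_add_left, inner_smul_left,
    ← S.norm_sq_weak_curl hBJ hψ hψK] at h
  simp only [conj_trivial] at h
  rw [← h]
  field_simp
  ring

/-- Energy balance at a fixed time: in the sum of the two balances the Lorentz force and the
electromotive force cancel, as `(curl B × B) · u = -(u × B) · curl B`. -/
theorem SkewProduct.energy_balance (hu : ZeroOnBoundary u Du) (hb : MemLp u ⊤ (vol Ω))
    (hdiv : HasWeakDiv u 0) (hB : MemLp B 3 (vol Ω)) (hBJ : S.HasWeakCocurl Ω B J)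
    {K : L2 Ω (Vec d)} (hJK : S.HasWeakCurl Ω J K)
    {ψ : ℕ → 𝓓(Ω, G)} (hψ : TestTendsto (Ω := Ω) 2 (fun n => ψ n) J)
    (hψK : TestTendsto (Ω := Ω) 2 (fun n => S.cocurl (ψ n)) K)
    {a b f : L2 Ω (Vec d)} {p : L2 Ω ℝ} {ν η s : ℝ} (hs : s ≠ 0)
    (hmom : ∀ φ : 𝓓(Ω, Vec d),
      ∫ x, inner ℝ (a x) (φ x) ∂(vol Ω)
        + ν * ∑ i, ∫ x, inner ℝ (Du i x) (pd i φ x) ∂(vol Ω)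
        + ∫ x, inner ℝ (advect (u x) fun i => Du i x) (φ x) ∂(vol Ω)
        - ∫ x, p x * divergence φ x ∂(vol Ω)
        - s * ∫ x, inner ℝ (S.act (J x) (B x)) (φ x) ∂(vol Ω)
      = ∫ x, inner ℝ (f x) (φ x) ∂(vol Ω))
    (hind : ∀ φ : 𝓓(Ω, Vec d),
      ∫ x, inner ℝ (b x) (φ x) ∂(vol Ω) + η * ∫ x, inner ℝ (J x) (S.curl φ x) ∂(vol Ω)
        - s * ∫ x, inner ℝ (S.cross (u x) (B x)) (S.curl φ x) ∂(vol Ω) = 0) :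
    inner ℝ a u + inner ℝ b B + ν * gradNormSq Du + η * ‖J‖ ^ 2 = inner ℝ f u := by
  have hN : Integrable (fun x => S.act (J x) (B x)) (vol Ω) := by
    refine ((Lp.memLp J).norm.integrable_mul (Lp.memLp B).norm |>.const_mul ‖S.act‖).mono'
      (S.act.aestronglyMeasurable_comp₂ (Lp.memLp J).1 (Lp.memLp B).1)
      (Eventually.of_forall fun x => ?_)
    simpa [mul_assoc] using S.act.le_opNorm₂ (J x) (B x)
  have h1 := hu.momentum_balance hb hdiv hN hmom
  have h2 := S.magnetic_balance hu hb hB hBJ hJK hψ hψK hs hind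
  have h3 : ∫ x, inner ℝ (S.cross (u x) (B x)) (J x) ∂(vol Ω) =
      -∫ x, inner ℝ (S.act (J x) (B x)) (u x) ∂(vol Ω) := by
    rw [← integral_neg]
    simp only [S.inner_cross]
  rw [h3] at h2
  linarith

end MagneticBalance

/-! ### The cross products in space and in the plane -/

/-- The cross product in `ℝ³`. -/
noncomputable def spatialProduct : SkewProduct 3 (Vec 3) :=
  let T : Vec 3 →L[ℝ] Vec 3 →L[ℝ] Vec 3 := LinearMap.toContinuousBilinearMap
    (LinearMap.mk₂ ℝ cross3 (by intros; simp [cross3]) (by intros; simp [cross3])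
      (by intros; simp [cross3]) (by intros; simp [cross3]))
  { cross := T
    act := T
    act_skew := fun j a b => by
      change inner ℝ (cross3 j a) b = -inner ℝ a (cross3 j b)
      simp [cross3, PiLp.inner_apply, Fin.sum_univ_three, cross_apply]
      ring
    inner_cross := fun v b j => by
      change inner ℝ (cross3 v b) j = -inner ℝ (cross3 j b) v
      simp [cross3, PiLp.inner_apply, Fin.sum_univ_three, cross_apply]
      ring }

theorem spatialProduct_cross (a b : Vec 3) : spatialProduct.cross a b = cross3 a b := rfl

theorem spatialProduct_act (a b : Vec 3) : spatialProduct.act a b = cross3 a b := rfl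

theorem spatialProduct_curl (φ : Vec 3 → Vec 3) : spatialProduct.curl φ = curl3 φ := by
  ext x i
  fin_cases i <;>
    simp [SkewProduct.curl, spatialProduct_cross, cross3, curl3, Fin.sum_univ_three, cross_apply]
      <;> ring

theorem spatialProduct_cocurl (φ : Vec 3 → Vec 3) : spatialProduct.cocurl φ = curl3 φ := by
  ext x i
  fin_cases i <;>
    simp [SkewProduct.cocurl, spatialProduct_act, cross3, curl3, Fin.sum_univ_three, cross_apply]
      <;> ring

/-- The cross product in `ℝ²`, with values in `ℝ`. -/
noncomputable def planarProduct : SkewProduct 2 ℝ where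
  cross := LinearMap.toContinuousBilinearMap
    (LinearMap.mk₂ ℝ cross2 (by intros; simp [cross2]; ring) (by intros; simp [cross2]; ring)
      (by intros; simp [cross2]; ring) (by intros; simp [cross2]; ring))
  act := LinearMap.toContinuousBilinearMap
    (LinearMap.mk₂ ℝ scross2
      (by intros; ext i; fin_cases i <;> simp [scross2] <;> ring)
      (by intros; ext i; fin_cases i <;> simp [scross2] <;> ring)
      (by intros; ext i; fin_cases i <;> simp [scross2] <;> ring)
      (by intros; ext i; fin_cases i <;> simp [scross2] <;> ring))
  act_skew j a b := by
    simp [scross2, PiLp.inner_apply, Fin.sum_univ_two]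
    ring
  inner_cross v b j := by
    simp [scross2, cross2, PiLp.inner_apply, Fin.sum_univ_two]
    ring

theorem planarProduct_cross (a b : Vec 2) : planarProduct.cross a b = cross2 a b := rfl

theorem planarProduct_act (s : ℝ) (b : Vec 2) : planarProduct.act s b = scross2 s b := rfl

theorem planarProduct_curl (φ : Vec 2 → Vec 2) : planarProduct.curl φ = curl2 φ := by
  ext x
  simp [SkewProduct.curl, planarProduct_cross, cross2, curl2]

theorem planarProduct_cocurl (w : Vec 2 → ℝ) : planarProduct.cocurl w = vcurl2 w := by
  ext x i
  fin_cases i <;> simp [SkewProduct.cocurl, planarProduct_act, scross2, vcurl2, Fin.sum_univ_two]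

theorem isFiniteMeasure_vol {d : ℕ} {Ω : Opens (Vec d)}
    (h : Bornology.IsBounded (Ω : Set (Vec d))) : IsFiniteMeasure (vol Ω) :=
  isFiniteMeasure_restrict.2 h.measure_lt_top.ne

theorem IsSolution3.energy_identity {Ω : Opens (Vec 3)} (hΩ : Bornology.IsBounded (Ω : Set (Vec 3)))
    {Re Rm Sc : ℝ} (hSc : 0 < Sc) {I : Set ℝ} {f u : ℝ → L2 Ω (Vec 3)}
    {Du : ℝ → Fin 3 → L2 Ω (Vec 3)} {p : ℝ → L2 Ω ℝ} {B J : ℝ → L2 Ω (Vec 3)}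
    (h : IsSolution3 Ω Re Rm Sc f I u Du p B J) {t : ℝ} (ht : t ∈ I) :
    inner ℝ (deriv u t) (u t) + inner ℝ (deriv B t) (B t) + 1 / Re * gradNormSq (Du t)
      + Sc / Rm * ‖J t‖ ^ 2 = inner ℝ (f t) (u t) := by
  have := isFiniteMeasure_vol hΩ
  obtain ⟨K, hK, ψ, hψ, hψK⟩ := h.boundary_curl_B t ht
  refine spatialProduct.energy_balance (h.boundary_u t ht) (h.bounded_u t ht) (h.div_u t ht)
    (h.integrable_B t ht) (fun φ => ?_) (K := K) (fun φ => ?_) hψ ?_ hSc.ne' (h.momentum t ht)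
    fun φ => ?_
  · rw [spatialProduct_cocurl]
    exact h.curl_B t ht φ
  · rw [spatialProduct_curl]
    exact hK φ
  · simpa only [spatialProduct_cocurl] using hψK
  · rw [spatialProduct_curl]
    exact h.induction_eq t ht φ

theorem IsSolution2.energy_identity {Ω : Opens (Vec 2)} (hΩ : Bornology.IsBounded (Ω : Set (Vec 2)))
    {Re Rm Sc : ℝ} (hSc : 0 < Sc) {I : Set ℝ} {f u : ℝ → L2 Ω (Vec 2)}
    {Du : ℝ → Fin 2 → L2 Ω (Vec 2)} {p : ℝ → L2 Ω ℝ} {B : ℝ → L2 Ω (Vec 2)} {J : ℝ → L2 Ω ℝ}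
    (h : IsSolution2 Ω Re Rm Sc f I u Du p B J) {t : ℝ} (ht : t ∈ I) :
    inner ℝ (deriv u t) (u t) + inner ℝ (deriv B t) (B t) + 1 / Re * gradNormSq (Du t)
      + Sc / Rm * ‖J t‖ ^ 2 = inner ℝ (f t) (u t) := by
  have := isFiniteMeasure_vol hΩ
  have hr : ∀ a b : ℝ, inner ℝ a b = a * b := fun a b => by simp [mul_comm]
  obtain ⟨K, hK, ψ, hψ, hψK⟩ := h.boundary_curl_B t ht
  refine planarProduct.energy_balance (h.boundary_u t ht) (h.bounded_u t ht) (h.div_u t ht)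
    (h.integrable_B t ht) (fun φ => ?_) (K := K) (fun φ => ?_) hψ ?_ hSc.ne' (h.momentum t ht)
    fun φ => ?_
  · rw [planarProduct_cocurl]
    simpa only [hr] using h.curl_B t ht φ
  · rw [planarProduct_curl]
    simpa only [hr] using hK φ
  · simpa only [planarProduct_cocurl] using hψK
  · rw [planarProduct_curl]
    simpa only [hr, planarProduct_cross] using h.induction_eq t ht φ

theorem half_deriv_norm_sq {H : Type*} [NormedAddCommGroup H] [InnerProductSpace ℝ H] {w : ℝ → H}
    {t : ℝ} (hw : DifferentiableAt ℝ w t) :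
    1 / 2 * deriv (fun s => ‖w s‖ ^ 2) t = inner ℝ (deriv w t) (w t) := by
  rw [hw.hasDerivAt.norm_sq.deriv, real_inner_comm]
  ring

end MHD

/-- Energy identity for the dynamical incompressible MHD equations, in dimension three and in
dimension two. -/
theorem mainTheorem3 (Re Rm Sc : ℝ) (hRe : 0 < Re) (hRm : 0 < Rm) (hSc : 0 < Sc) (I : Set ℝ) :
    (∀ (Ω : TopologicalSpace.Opens (MHD.Vec 3)), Bornology.IsBounded (Ω : Set (MHD.Vec 3)) →
      ∀ (f u : ℝ → MHD.L2 Ω (MHD.Vec 3)) (Du : ℝ → Fin 3 → MHD.L2 Ω (MHD.Vec 3))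
        (p : ℝ → MHD.L2 Ω ℝ) (B J : ℝ → MHD.L2 Ω (MHD.Vec 3)),
        MHD.IsSolution3 Ω Re Rm Sc f I u Du p B J →
        ∀ t ∈ I,
          DifferentiableAt ℝ (fun s => ‖u s‖ ^ 2) t ∧ DifferentiableAt ℝ (fun s => ‖B s‖ ^ 2) t ∧
          1 / 2 * deriv (fun s => ‖u s‖ ^ 2) t + 1 / 2 * deriv (fun s => ‖B s‖ ^ 2) t
            + 1 / Re * MHD.gradNormSq (Du t) + Sc / Rm * ‖J t‖ ^ 2
          = inner ℝ (f t) (u t)) ∧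
    (∀ (Ω : TopologicalSpace.Opens (MHD.Vec 2)), Bornology.IsBounded (Ω : Set (MHD.Vec 2)) →
      ∀ (f u : ℝ → MHD.L2 Ω (MHD.Vec 2)) (Du : ℝ → Fin 2 → MHD.L2 Ω (MHD.Vec 2))
        (p : ℝ → MHD.L2 Ω ℝ) (B : ℝ → MHD.L2 Ω (MHD.Vec 2)) (J : ℝ → MHD.L2 Ω ℝ),
        MHD.IsSolution2 Ω Re Rm Sc f I u Du p B J →
        ∀ t ∈ I,
          DifferentiableAt ℝ (fun s => ‖u s‖ ^ 2) t ∧ DifferentiableAt ℝ (fun s => ‖B s‖ ^ 2) t ∧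
          1 / 2 * deriv (fun s => ‖u s‖ ^ 2) t + 1 / 2 * deriv (fun s => ‖B s‖ ^ 2) t
            + 1 / Re * MHD.gradNormSq (Du t) + Sc / Rm * ‖J t‖ ^ 2
          = inner ℝ (f t) (u t)) := by
  refine ⟨fun Ω hΩ f u Du p B J h t ht => ?_, fun Ω hΩ f u Du p B J h t ht => ?_⟩
  · have hu := h.differentiable_u t ht
    have hB := h.differentiable_B t ht
    refine ⟨hu.norm_sq ℝ, hB.norm_sq ℝ, ?_⟩
    rw [MHD.half_deriv_norm_sq hu, MHD.half_deriv_norm_sq hB]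
    exact h.energy_identity hΩ hSc ht
  · have hu := h.differentiable_u t ht
    have hB := h.differentiable_B t ht
    refine ⟨hu.norm_sq ℝ, hB.norm_sq ℝ, ?_⟩
    rw [MHD.half_deriv_norm_sq hu, MHD.half_deriv_norm_sq hB]
    exact h.energy_identity hΩ hSc ht
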